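/- \textbf{Conventions.} Fix a universe of sets containing the unit interval $[0,1]$; its members are called tiny. An \emph{indexed preorder} $\mathbf P$ on a category $\mathcal C$ with finite products is a pseudofunctor from $\mathcal C^{op}$ to preorders. It is a \emph{universally coherent hyperdoctrine} if its fibres are preorders whose poset reflections are bounded distributive lattices, reindexing preserves this lattice structure, there are equality predicates $Eq_X\in\mathbf P(X\times X)$ (with $\top\le\delta^*A\iff Eq_X\le A$ for the diagonal $\delta$, and $Eq_{A\times B}\simeq\pi_{13}^*Eq_A\wedge\pi_{24}^*Eq_B$), and reindexing along every product projection has a left adjoint $\exists$ satisfying the Frobenius and Beck--Chevalley conditions and a right adjoint $\forall$ satisfying the Beck--Chevalley condition. A \emph{morphism} $\mathbf P\to\mathbf Q$ of such hyperdoctrines is a pair $(F,\eta)$ of a finite-product-preserving functor $F$ between the bases and a pseudonatural family $\eta_X:\mathbf P(X)\to\mathbf Q(FX)$ of maps preserving the order, finite meets, finite joins, $\exists$ and $\forall$ along projections, and equality, i.e. $\eta_{X\times X}(Eq_X)\simeq\langle F\pi_1,F\pi_2\rangle^*Eq_{FX}$. It is an \emph{embedding} if $F$ is full and faithful and $\eta_X(\alpha)\le\eta_X(\beta)\iff\alpha\le\beta$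 for all $X,\alpha,\beta$. For functions $\alpha,\beta:X\to[0,1]$ write $\alpha\sqsubseteq\beta$ if for every $\varepsilon>0$ there is $\delta>0$ such that $\alpha(x)\le\delta$ implies $\beta(x)\le\varepsilon$ for all $x\in X$. Let $\mathbf U^t$ be the hyperdoctrine on tiny sets with $\mathbf U^t(X)=(\{X\to[0,1]\},\sqsubseteq)$ and reindexing by precomposition (so $\wedge=\max$, $\vee=\min$, and $\exists=\inf$, with $\inf\emptyset=1$). Let $\mathbf{cMet}_1^t$ be the category of complete metric spaces of diameter at most $1$ with tiny underlying set and uniformly continuous maps, and let $\mathbf{CMT}^t$ be the indexed preorder on it whose predicates on $(X,d)$ are the uniformly continuous functions $X\to[0,1]$, ordered by $\sqsubseteq$, with reindexing by precomposition. Let $\mathrm{PER}(\mathbf U^t)$ be the category of partial equivalence relations over $\mathbf U^t$: objects are pairs $(X,\sim)$ of a tiny set $X$ and a symmetric and transitive $\sim\ \in\mathbf U^t(X\times X)$; morphisms $(X,\sim)\to(Y,\sim)$ are classes, up to mutual entailment, of strict, relational, single-valued and total $F\in\mathbf U^t(X\times Y)$; composition is given by $\exists y\,(F(x,y)\wedge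 G(y,z))$. Let $G:\mathbf{cMet}_1^t\to\mathrm{PER}(\mathbf U^t)$ send $(X,d)$ to $(X,d)$ and a map $f$ to the class of $(x,y)\mapsto d(f(x),y)$. \textbf{Theorem.} Call a sieve on an object $A$ of $\mathrm{PER}(\mathbf U^t)$ covering if it contains a finite family of morphisms into $A$ the union of whose images is $A$. These covering sieves form a subcanonical Grothendieck topology $J$ on $\mathrm{PER}(\mathbf U^t)$ (the coherent topology). The category $\mathcal E=\mathrm{Sh}(\mathrm{PER}(\mathbf U^t),J)$ is a Grothendieck topos; both $\mathbf{CMT}^t$ and the subobject hyperdoctrine $\mathrm{Sub}_{\mathcal E}$ are universally coherent hyperdoctrines; and there is an embedding of universally coherent hyperdoctrines \[(F,\eta):\mathbf{CMT}^t\longrightarrow \mathrm{Sub}_{\mathcal E},\qquad F=y\circ G,\] where $y:\mathrm{PER}(\mathbf U^t)\to\mathcal E$ is the Yoneda embedding. Here $\eta_{(X,d)}(\varphi)$ is the subobject of $y(G(X,d))$ represented by the image under $y$ of the subobject of $G(X,d)$ in $\mathrm{PER}(\mathbf U^t)$ given by the strict relation $\varphi$, that is, of the inclusion of $(X,\sim_\varphi)$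 with $x\sim_\varphi x'$ defined as $\max(\varphi(x),d(x,x'))$. -/

import Mathlib

open CategoryTheory CategoryTheory.Limits

universe w v u

namespace ContLogic

/-! ## Indexed preorders and universally coherent hyperdoctrines -/

section Hyperdoctrines

/-- An indexed preorder on `C`: a pseudofunctor from `Cᵒᵖ` to the 2-category of preorders.
Parallel 2-cells between monotone maps are unique, so the comparison isomorphisms are mere
properties and all coherence conditions are automatic. -/
structure IndexedPreorder (C : Type u) [Category.{v} C] where
  /-- the predicates on an object -/
  Pred : C → Type w
  [preorder : ∀ X, Preorder (Pred X)]
  /-- reindexing along a morphism -/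
  map : ∀ {X Y : C}, (X ⟶ Y) → Pred Y →o Pred X
  map_id : ∀ (X : C) (α : Pred X), AntisymmRel (· ≤ ·) (map (𝟙 X) α) α
  map_comp : ∀ {X Y Z : C} (f : X ⟶ Y) (g : Y ⟶ Z) (α : Pred Z),
    AntisymmRel (· ≤ ·) (map (f ≫ g) α) (map f (map g α))

attribute [instance] IndexedPreorder.preorder

/-- A preorder whose poset reflection is a (bounded) distributive lattice. -/
structure IsDistPrelattice (A : Type w) [Preorder A] : Prop where
  exists_top : ∃ t : A, IsTop t
  exists_bot : ∃ b : A, IsBot b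
  exists_meet : ∀ a b : A, ∃ m, IsGLB {a, b} m
  exists_join : ∀ a b : A, ∃ j, IsLUB {a, b} j
  /-- `a ∧ (b ∨ c)` is a join of `a ∧ b` and `a ∧ c` -/
  distrib : ∀ a b c bc a_bc ab ac : A, IsLUB {b, c} bc → IsGLB {a, bc} a_bc →
    IsGLB {a, b} ab → IsGLB {a, c} ac → IsLUB {ab, ac} a_bc

/-- A monotone map whose poset reflection is a homomorphism of (bounded) lattices. -/
structure IsPrelatticeHom {A : Type*} {B : Type*} [Preorder A] [Preorder B] (f : A → B) :
    Prop where
  monotone : Monotone f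
  map_top : ∀ t, IsTop t → IsTop (f t)
  map_bot : ∀ b, IsBot b → IsBot (f b)
  map_meet : ∀ a b m, IsGLB {a, b} m → IsGLB {f a, f b} (f m)
  map_join : ∀ a b j, IsLUB {a, b} j → IsLUB {f a, f b} (f j)

/-- `p : Z ⟶ X` is a product projection: for some `q : Z ⟶ Y`, the pair `(p, q)` exhibits `Z`
as a product of `X` and `Y`. -/
def IsProjection {C : Type u} [Category.{v} C] {Z X : C} (p : Z ⟶ X) : Prop :=
  ∃ (Y : C) (q : Z ⟶ Y), Nonempty (IsLimit (BinaryFan.mk p q))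

variable {C : Type u} [Category.{v} C]

/-- `e` is (up to isomorphism) the value `∃_π α` of the left adjoint of reindexing along `π`. -/
def IndexedPreorder.IsExists (P : IndexedPreorder.{w} C) {Y X : C} (π : Y ⟶ X)
    (α : P.Pred Y) (e : P.Pred X) : Prop :=
  ∀ β : P.Pred X, e ≤ β ↔ α ≤ P.map π β

/-- `e` is (up to isomorphism) the value `∀_π α` of the right adjoint of reindexing along `π`. -/
def IndexedPreorder.IsForall (P : IndexedPreorder.{w} C) {Y X : C} (π : Y ⟶ X)
    (α : P.Pred Y) (e : P.Pred X) : Prop :=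
  ∀ β : P.Pred X, β ≤ e ↔ P.map π β ≤ α

/-- `e` is (up to isomorphism) the equality predicate on `X`: for all predicates `A` on `X ⨯ X`,
`⊤ ≤ δ^* A` if and only if `e ≤ A`. -/
def IndexedPreorder.IsEq [HasFiniteProducts C] (P : IndexedPreorder.{w} C) (X : C)
    (e : P.Pred (X ⨯ X)) : Prop :=
  ∀ A : P.Pred (X ⨯ X), IsTop (P.map (diag X) A) ↔ e ≤ A

/-- Universally coherent hyperdoctrines: the fibres are distributive prelattices and reindexing
preserves that structure; there are equality predicates; reindexing along product projections has
left adjoints satisfying Frobenius and Beck-Chevalley and right adjoints satisfying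
Beck-Chevalley. -/
structure IndexedPreorder.IsUniversallyCoherent [HasFiniteProducts C]
    (P : IndexedPreorder.{w} C) : Prop where
  distPrelattice : ∀ X, IsDistPrelattice (P.Pred X)
  prelatticeHom : ∀ {X Y : C} (f : X ⟶ Y), IsPrelatticeHom (P.map f)
  exists_eq : ∀ X, ∃ e, P.IsEq X e
  eq_prod : ∀ (A B : C) (eA : P.Pred (A ⨯ A)) (eB : P.Pred (B ⨯ B))
    (eAB : P.Pred ((A ⨯ B) ⨯ (A ⨯ B))), P.IsEq A eA → P.IsEq B eB → P.IsEq (A ⨯ B) eAB →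
    IsGLB {P.map (prod.map (prod.fst : A ⨯ B ⟶ A) (prod.fst : A ⨯ B ⟶ A)) eA,
      P.map (prod.map (prod.snd : A ⨯ B ⟶ B) (prod.snd : A ⨯ B ⟶ B)) eB} eAB
  exists_exists : ∀ {Y X : C} (π : Y ⟶ X), IsProjection π → ∀ α, ∃ e, P.IsExists π α e
  exists_forall : ∀ {Y X : C} (π : Y ⟶ X), IsProjection π → ∀ α, ∃ e, P.IsForall π α e
  frobenius : ∀ {Y X : C} (π : Y ⟶ X), IsProjection π → ∀ (α : P.Pred X) (β : P.Pred Y)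
    (e m : P.Pred X) (k : P.Pred Y), P.IsExists π β e → IsGLB {α, e} m →
    IsGLB {P.map π α, β} k → P.IsExists π k m
  beckChevalley_exists : ∀ {A B D E : C} (π : A ⟶ B) (f : A ⟶ D) (g : B ⟶ E) (π' : D ⟶ E),
    IsPullback π f g π' → IsProjection π → IsProjection π' →
    ∀ (α : P.Pred D) (e : P.Pred E), P.IsExists π' α e → P.IsExists π (P.map f α) (P.map g e)
  beckChevalley_forall : ∀ {A B D E : C} (π : A ⟶ B) (f : A ⟶ D) (g : B ⟶ E) (π' : D ⟶ E),
    IsPullback π f g π' → IsProjection π → IsProjection π' →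
    ∀ (α : P.Pred D) (e : P.Pred E), P.IsForall π' α e → P.IsForall π (P.map f α) (P.map g e)

/-- `(F, η)` is a morphism of universally coherent hyperdoctrines from `P` to `Q`. -/
structure IsHyperdoctrineMorphism {D : Type*} [Category* D] [HasFiniteProducts C]
    [HasFiniteProducts D] (P : IndexedPreorder.{w} C) (Q : IndexedPreorder D) (F : C ⥤ D)
    (η : ∀ X : C, P.Pred X → Q.Pred (F.obj X)) : Prop where
  preservesFiniteProducts : PreservesFiniteProducts F
  prelatticeHom : ∀ X, IsPrelatticeHom (η X)
  natural : ∀ {X Y : C} (f : X ⟶ Y) (α : P.Pred Y),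
    AntisymmRel (· ≤ ·) (η X (P.map f α)) (Q.map (F.map f) (η Y α))
  map_exists : ∀ {Y X : C} (π : Y ⟶ X), IsProjection π → ∀ α e,
    P.IsExists π α e → Q.IsExists (F.map π) (η Y α) (η X e)
  map_forall : ∀ {Y X : C} (π : Y ⟶ X), IsProjection π → ∀ α e,
    P.IsForall π α e → Q.IsForall (F.map π) (η Y α) (η X e)
  map_eq : ∀ (X : C) (e : P.Pred (X ⨯ X)) (e' : Q.Pred (F.obj X ⨯ F.obj X)),
    P.IsEq X e → Q.IsEq (F.obj X) e' →
    AntisymmRel (· ≤ ·) (η (X ⨯ X) e) (Q.map (prodComparison F X X) e')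

/-- `(F, η)` is a full morphism, i.e. an embedding, of universally coherent hyperdoctrines. -/
structure IsHyperdoctrineEmbedding {D : Type*} [Category* D] [HasFiniteProducts C]
    [HasFiniteProducts D] (P : IndexedPreorder.{w} C) (Q : IndexedPreorder D) (F : C ⥤ D)
    (η : ∀ X : C, P.Pred X → Q.Pred (F.obj X)) : Prop
    extends IsHyperdoctrineMorphism P Q F η where
  full : F.Full
  faithful : F.Faithful
  le_iff_le : ∀ (X : C) (α β : P.Pred X), η X α ≤ η X β ↔ α ≤ β

/-- The subobject hyperdoctrine: predicates are subobjects, reindexing is pullback. -/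
noncomputable def subDoctrine (E : Type u) [Category.{v} E] [HasPullbacks E] :
    IndexedPreorder E where
  Pred X := Subobject X
  map f := ⟨(Subobject.pullback f).obj, (Subobject.pullback f).monotone⟩
  map_id X α := by
    have h : (Subobject.pullback (𝟙 X)).obj α = α := Subobject.pullback_id α
    exact ⟨h.le, h.ge⟩
  map_comp f g α := by
    have h : (Subobject.pullback (f ≫ g)).obj α =
        (Subobject.pullback f).obj ((Subobject.pullback g).obj α) := Subobject.pullback_comp f g α
    exact ⟨h.le, h.ge⟩

end Hyperdoctrines

/-! ## Grothendieck toposes and coherent coverings -/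

/-- A sieve on `X` is a covering sieve for the coherent topology if it contains a finite family of
morphisms the union of whose images is `X`. The union of the images is the least subobject of `X`
through which all members of the family factor. -/
def IsCoherentCovering {C : Type u} [Category.{v} C] {X : C} (S : Sieve X) : Prop :=
  ∃ (n : ℕ) (Y : Fin n → C) (f : ∀ i, Y i ⟶ X), (∀ i, S (f i)) ∧
    ∀ A : Subobject X, (∀ i, A.Factors (f i)) → A = ⊤

/-- A Grothendieck topos (over the sets in `Type w`): a category equivalent to the category of
sheaves of sets on a small site. -/
def IsGrothendieckTopos (E : Type u) [Category.{v} E] : Prop :=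
  ∃ (C : Type w) (_ : SmallCategory.{w} C) (J : GrothendieckTopology C),
    Nonempty (E ≌ Sheaf J (Type w))

/-! ## The order on `[0,1]`-valued predicates -/

/-- The unit interval. Infima are taken in it, so the infimum of the empty family is `1`. -/
abbrev I : Type := unitInterval

/-- The preorder `α ⊑ β` on functions `X → [0,1]`. The value `0` is "true"; conjunction is `⊔`
(maximum), disjunction is `⊓`, existential quantification is `⨅`. The preorders `(X → [0,1], ⊑)`
are the fibres of the hyperdoctrine `U`. -/
def Entails {X : Type u} (α β : X → I) : Prop :=
  ∀ ε : ℝ, 0 < ε → ∃ δ : ℝ, 0 < δ ∧ ∀ x, (α x : ℝ) ≤ δ → (β x : ℝ) ≤ ε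

/-- Auxiliary: the sequence `a` converges to `0`. -/
def Vanishes (a : ℕ → I) : Prop :=
  ∀ ε : ℝ, 0 < ε → ∃ N, ∀ n, N ≤ n → (a n : ℝ) ≤ ε

theorem entails_iff_seq {X : Type u} {α β : X → I} :
    Entails α β ↔ ∀ x : ℕ → X, Vanishes (fun n => α (x n)) → Vanishes (fun n => β (x n)) := by
  constructor
  · intro h x hx ε hε
    obtain ⟨δ, hδ, H⟩ := h ε hε
    obtain ⟨N, hN⟩ := hx δ hδ
    exact ⟨N, fun n hn => H _ (hN n hn)⟩
  · intro h ε hε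
    by_contra hc
    push Not at hc
    choose x hx hx' using fun n : ℕ => hc (1 / ((n : ℝ) + 1)) (by positivity)
    obtain ⟨N, hN⟩ := h x (fun ε' hε' => by
      obtain ⟨N, hN⟩ := exists_nat_one_div_lt hε'
      refine ⟨N, fun n hn => (hx n).trans (le_trans ?_ hN.le)⟩
      have : (N : ℝ) ≤ n := by exact_mod_cast hn
      gcongr) ε hε
    exact absurd (hN N le_rfl) (not_le.mpr (hx' N))

theorem vanishes_sup {a b : ℕ → I} :
    Vanishes (fun n => a n ⊔ b n) ↔ Vanishes a ∧ Vanishes b := by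
  constructor
  · intro h
    refine ⟨fun ε hε => ?_, fun ε hε => ?_⟩ <;> obtain ⟨N, hN⟩ := h ε hε <;>
      refine ⟨N, fun n hn => le_trans ?_ (hN n hn)⟩
    · exact_mod_cast (le_sup_left : a n ≤ a n ⊔ b n)
    · exact_mod_cast (le_sup_right : b n ≤ a n ⊔ b n)
  · rintro ⟨h, h'⟩ ε hε
    obtain ⟨N, hN⟩ := h ε hε
    obtain ⟨M, hM⟩ := h' ε hε
    refine ⟨max N M, fun n hn => ?_⟩
    rcases le_total (a n) (b n) with hab | hab
    · change ((a n ⊔ b n : I) : ℝ) ≤ ε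
      rw [sup_eq_right.mpr hab]; exact hM n (le_of_max_le_right hn)
    · change ((a n ⊔ b n : I) : ℝ) ≤ ε
      rw [sup_eq_left.mpr hab]; exact hN n (le_of_max_le_left hn)

theorem vanishes_iInf {Y : Type u} {a : ℕ → Y → I} :
    Vanishes (fun n => ⨅ y, a n y) ↔ ∃ y : ℕ → Y, Vanishes (fun n => a n (y n)) := by
  constructor
  · intro h
    have hne : Nonempty Y := by
      by_contra hY
      rw [not_nonempty_iff] at hY
      obtain ⟨N, hN⟩ := h (1 / 2) (by norm_num)
      have : ((⨅ y, a N y : I) : ℝ) ≤ 1 / 2 := hN N le_rfl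
      rw [iInf_of_empty] at this
      norm_num at this
    have key : ∀ n : ℕ, ∃ y, (a n y : ℝ) ≤ ((⨅ y, a n y : I) : ℝ) + 1 / ((n : ℝ) + 1) := by
      intro n
      by_contra hc
      push Not at hc
      have hpos : (0 : ℝ) < 1 / ((n : ℝ) + 1) := by positivity
      set i : I := ⨅ y, a n y with hi
      obtain ⟨y0⟩ := hne
      have hmem : (i : ℝ) + 1 / ((n : ℝ) + 1) ∈ unitInterval :=
        ⟨add_nonneg i.2.1 hpos.le, (hc y0).le.trans (a n y0).2.2⟩
      have : (⟨_, hmem⟩ : I) ≤ i := le_iInf fun y => (hc y).le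
      have h2 : (i : ℝ) + 1 / ((n : ℝ) + 1) ≤ (i : ℝ) := this
      linarith
    choose y hy using key
    refine ⟨y, fun ε hε => ?_⟩
    obtain ⟨N, hN⟩ := h (ε / 2) (by positivity)
    obtain ⟨M, hM⟩ := exists_nat_one_div_lt (show (0 : ℝ) < ε / 2 by positivity)
    refine ⟨max N M, fun n hn => (hy n).trans ?_⟩
    have h1 := hN n (le_of_max_le_left hn)
    have h2 : 1 / ((n : ℝ) + 1) ≤ 1 / ((M : ℝ) + 1) := by
      have : (M : ℝ) ≤ n := by exact_mod_cast le_of_max_le_right hn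
      gcongr
    linarith
  · rintro ⟨y, hy⟩ ε hε
    obtain ⟨N, hN⟩ := hy ε hε
    refine ⟨N, fun n hn => le_trans ?_ (hN n hn)⟩
    exact_mod_cast (iInf_le (a n) (y n) : ⨅ y, a n y ≤ a n (y n))

theorem Entails.seq {X : Type u} {α β : X → I} (h : Entails α β) (x : ℕ → X)
    (hx : Vanishes (fun n => α (x n))) : Vanishes (fun n => β (x n)) :=
  entails_iff_seq.mp h x hx

theorem Entails.refl {X : Type u} (α : X → I) : Entails α α := fun ε hε => ⟨ε, hε, fun _ h => h⟩

theorem Entails.trans {X : Type u} {α β γ : X → I} (h : Entails α β) (h' : Entails β γ) :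
    Entails α γ :=
  entails_iff_seq.mpr fun x hx => h'.seq x (h.seq x hx)

/-! ## Partial equivalence relations over `U` -/

/-- Partial equivalence relations over `U`, with underlying set in `Type u`. -/
structure PERU : Type (u + 1) where
  carrier : Type u
  rel : carrier → carrier → I
  /-- `x ∼ y ⊢ y ∼ x` -/
  symm : Entails (fun p : carrier × carrier => rel p.1 p.2) (fun p => rel p.2 p.1)
  /-- `x ∼ y ∧ y ∼ z ⊢ x ∼ z` -/
  trans : Entails (fun p : carrier × carrier × carrier => rel p.1 p.2.1 ⊔ rel p.2.1 p.2.2)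
    (fun p => rel p.1 p.2.2)

namespace PERU

theorem symm_seq (A : PERU.{u}) {x y : ℕ → A.carrier} (h : Vanishes fun n => A.rel (x n) (y n)) :
    Vanishes fun n => A.rel (y n) (x n) :=
  A.symm.seq (fun n => (x n, y n)) h

theorem trans_seq (A : PERU.{u}) {x y z : ℕ → A.carrier}
    (h : Vanishes fun n => A.rel (x n) (y n)) (h' : Vanishes fun n => A.rel (y n) (z n)) :
    Vanishes fun n => A.rel (x n) (z n) :=
  A.trans.seq (fun n => (x n, y n, z n)) (vanishes_sup.mpr ⟨h, h'⟩)

/-- Functional relations from `A` to `B`. -/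
structure IsFunctional (A B : PERU.{u}) (F : A.carrier → B.carrier → I) : Prop where
  /-- `F(x,y) ⊢ x ∼ x ∧ y ∼ y` -/
  strict : Entails (fun p : A.carrier × B.carrier => F p.1 p.2)
    (fun p => A.rel p.1 p.1 ⊔ B.rel p.2 p.2)
  /-- `F(x,y) ∧ x ∼ x' ∧ y ∼ y' ⊢ F(x',y')`, the variables being `(x, x', y, y')` -/
  relational : Entails
    (fun p : A.carrier × A.carrier × B.carrier × B.carrier =>
      F p.1 p.2.2.1 ⊔ A.rel p.1 p.2.1 ⊔ B.rel p.2.2.1 p.2.2.2)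
    (fun p => F p.2.1 p.2.2.2)
  /-- `F(x,y) ∧ F(x,y') ⊢ y ∼ y'` -/
  singleValued : Entails (fun p : A.carrier × B.carrier × B.carrier => F p.1 p.2.1 ⊔ F p.1 p.2.2)
    (fun p => B.rel p.2.1 p.2.2)
  /-- `x ∼ x ⊢ ∃ y, F(x,y)` -/
  total : Entails (fun x : A.carrier => A.rel x x) (fun x => ⨅ y, F x y)

namespace IsFunctional

variable {A B C : PERU.{u}} {F : A.carrier → B.carrier → I} {G : B.carrier → C.carrier → I}

theorem strict_seq (h : IsFunctional A B F) {x : ℕ → A.carrier} {y : ℕ → B.carrier}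
    (hF : Vanishes fun n => F (x n) (y n)) :
    Vanishes (fun n => A.rel (x n) (x n)) ∧ Vanishes (fun n => B.rel (y n) (y n)) :=
  vanishes_sup.mp (h.strict.seq (fun n => (x n, y n)) hF)

theorem relational_seq (h : IsFunctional A B F) {x x' : ℕ → A.carrier} {y y' : ℕ → B.carrier}
    (hF : Vanishes fun n => F (x n) (y n)) (hx : Vanishes fun n => A.rel (x n) (x' n))
    (hy : Vanishes fun n => B.rel (y n) (y' n)) : Vanishes fun n => F (x' n) (y' n) :=
  h.relational.seq (fun n => (x n, x' n, y n, y' n))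
    (vanishes_sup.mpr ⟨vanishes_sup.mpr ⟨hF, hx⟩, hy⟩)

theorem singleValued_seq (h : IsFunctional A B F) {x : ℕ → A.carrier} {y y' : ℕ → B.carrier}
    (hF : Vanishes fun n => F (x n) (y n)) (hF' : Vanishes fun n => F (x n) (y' n)) :
    Vanishes fun n => B.rel (y n) (y' n) :=
  h.singleValued.seq (fun n => (x n, y n, y' n)) (vanishes_sup.mpr ⟨hF, hF'⟩)

theorem total_seq (h : IsFunctional A B F) {x : ℕ → A.carrier}
    (hx : Vanishes fun n => A.rel (x n) (x n)) :
    ∃ y : ℕ → B.carrier, Vanishes fun n => F (x n) (y n) :=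
  vanishes_iInf.mp (h.total.seq x hx)

theorem of_seq
    (h1 : ∀ (x : ℕ → A.carrier) (y : ℕ → B.carrier), Vanishes (fun n => F (x n) (y n)) →
      Vanishes (fun n => A.rel (x n) (x n)) ∧ Vanishes (fun n => B.rel (y n) (y n)))
    (h2 : ∀ (x x' : ℕ → A.carrier) (y y' : ℕ → B.carrier), Vanishes (fun n => F (x n) (y n)) →
      Vanishes (fun n => A.rel (x n) (x' n)) → Vanishes (fun n => B.rel (y n) (y' n)) →
      Vanishes (fun n => F (x' n) (y' n)))
    (h3 : ∀ (x : ℕ → A.carrier) (y y' : ℕ → B.carrier), Vanishes (fun n => F (x n) (y n)) →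
      Vanishes (fun n => F (x n) (y' n)) → Vanishes (fun n => B.rel (y n) (y' n)))
    (h4 : ∀ x : ℕ → A.carrier, Vanishes (fun n => A.rel (x n) (x n)) →
      ∃ y : ℕ → B.carrier, Vanishes (fun n => F (x n) (y n))) : IsFunctional A B F where
  strict := entails_iff_seq.mpr fun p hp => vanishes_sup.mpr (h1 _ _ hp)
  relational := entails_iff_seq.mpr fun p hp => by
    rw [vanishes_sup, vanishes_sup] at hp
    exact h2 _ _ _ _ hp.1.1 hp.1.2 hp.2
  singleValued := entails_iff_seq.mpr fun p hp => by
    rw [vanishes_sup] at hp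
    exact h3 _ _ _ hp.1 hp.2
  total := entails_iff_seq.mpr fun x hx => vanishes_iInf.mpr (h4 x hx)

theorem id (A : PERU.{u}) : IsFunctional A A A.rel :=
  of_seq (fun _ _ h => ⟨A.trans_seq h (A.symm_seq h), A.trans_seq (A.symm_seq h) h⟩)
    (fun _ _ _ _ h hx hy => A.trans_seq (A.symm_seq hx) (A.trans_seq h hy))
    (fun _ _ _ h h' => A.trans_seq (A.symm_seq h) h') (fun x hx => ⟨x, hx⟩)

theorem comp (hF : IsFunctional A B F) (hG : IsFunctional B C G) :
    IsFunctional A C (fun x z => ⨅ y, F x y ⊔ G y z) := by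
  have key : ∀ (x : ℕ → A.carrier) (z : ℕ → C.carrier),
      Vanishes (fun n => ⨅ y, F (x n) y ⊔ G y (z n)) ↔
      ∃ y : ℕ → B.carrier, Vanishes (fun n => F (x n) (y n)) ∧
        Vanishes (fun n => G (y n) (z n)) := fun x z => by
    rw [vanishes_iInf]; simp only [vanishes_sup]
  refine of_seq ?_ ?_ ?_ ?_ <;> simp only [key]
  · rintro x z ⟨y, h, h'⟩
    exact ⟨(hF.strict_seq h).1, (hG.strict_seq h').2⟩
  · rintro x x' z z' ⟨y, h, h'⟩ hx hz
    exact ⟨y, hF.relational_seq h hx (hF.strict_seq h).2,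
      hG.relational_seq h' (hF.strict_seq h).2 hz⟩
  · rintro x z z' ⟨y, h1, h2⟩ ⟨y', h1', h2'⟩
    exact hG.singleValued_seq
      (hG.relational_seq h2 (hF.singleValued_seq h1 h1') (hG.strict_seq h2).2) h2'
  · intro x hx
    obtain ⟨y, hy⟩ := hF.total_seq hx
    obtain ⟨z, hz⟩ := hG.total_seq (hF.strict_seq hy).2
    exact ⟨z, y, hy, hz⟩

end IsFunctional

/-- Functional relations `F`, `G` are identified when `F(x,y) ⊢ G(x,y)` and `G(x,y) ⊢ F(x,y)`
(either of the two implies the other). -/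
instance funSetoid (A B : PERU.{u}) :
    Setoid {F : A.carrier → B.carrier → I // IsFunctional A B F} where
  r F G := Entails (fun p : A.carrier × B.carrier => F.1 p.1 p.2) (fun p => G.1 p.1 p.2) ∧
    Entails (fun p : A.carrier × B.carrier => G.1 p.1 p.2) (fun p => F.1 p.1 p.2)
  iseqv :=
    { refl := fun _ => ⟨Entails.refl _, Entails.refl _⟩
      symm := fun h => ⟨h.2, h.1⟩
      trans := fun h h' => ⟨h.1.trans h'.1, h'.2.trans h.2⟩ }

/-- Morphisms of partial equivalence relations: functional relations up to equivalence. -/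
def Hom (A B : PERU.{u}) : Type u := Quotient (funSetoid A B)

/-- The morphism represented by a functional relation. -/
def homMk {A B : PERU.{u}} (F : A.carrier → B.carrier → I) (hF : IsFunctional A B F) : Hom A B :=
  Quotient.mk (funSetoid A B) ⟨F, hF⟩

theorem homMk_eq {A B : PERU.{u}} {F G : A.carrier → B.carrier → I} {hF : IsFunctional A B F}
    {hG : IsFunctional A B G}
    (h : ∀ (x : ℕ → A.carrier) (y : ℕ → B.carrier), Vanishes (fun n => F (x n) (y n)) ↔ Vanishes (fun n => G (x n) (y n))) :
    homMk F hF = homMk G hG :=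
  Quotient.sound ⟨entails_iff_seq.mpr fun p => (h (fun n => (p n).1) (fun n => (p n).2)).mp,
    entails_iff_seq.mpr fun p => (h (fun n => (p n).1) (fun n => (p n).2)).mpr⟩

/-- Composition of `F` and `G` is represented by `∃ y, F(x,y) ∧ G(y,z)`. -/
noncomputable def Hom.comp {A B C : PERU.{u}} (f : Hom A B) (g : Hom B C) : Hom A C :=
  Quotient.liftOn₂ f g (fun F G => homMk (fun x z => ⨅ y, F.1 x y ⊔ G.1 y z) (F.2.comp G.2))
    (by
      intro F G F' G' hF hG
      apply homMk_eq
      intro x z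
      simp only [vanishes_iInf, vanishes_sup]
      constructor
      · rintro ⟨y, h, h'⟩
        exact ⟨y, hF.1.seq (fun n => (x n, y n)) h, hG.1.seq (fun n => (y n, z n)) h'⟩
      · rintro ⟨y, h, h'⟩
        exact ⟨y, hF.2.seq (fun n => (x n, y n)) h, hG.2.seq (fun n => (y n, z n)) h'⟩)

/-- The category `PER(U)` (for sets in `Type u`). -/
noncomputable instance : Category.{u} PERU.{u} where
  Hom := Hom
  id A := homMk A.rel (IsFunctional.id A)
  comp := Hom.comp
  id_comp := by
    rintro A B ⟨F, hF⟩
    apply homMk_eq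
    intro x y
    simp only [vanishes_iInf, vanishes_sup]
    constructor
    · rintro ⟨x', h, h'⟩
      exact hF.relational_seq h' (A.symm_seq h) (hF.strict_seq h').2
    · exact fun h => ⟨x, (hF.strict_seq h).1, h⟩
  comp_id := by
    rintro A B ⟨F, hF⟩
    apply homMk_eq
    intro x y
    simp only [vanishes_iInf, vanishes_sup]
    constructor
    · rintro ⟨y', h, h'⟩
      exact hF.relational_seq h (hF.strict_seq h).1 h'
    · exact fun h => ⟨y, h, (hF.strict_seq h).2⟩
  assoc := by
    rintro A B C D ⟨F, hF⟩ ⟨G, hG⟩ ⟨H, hH⟩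
    apply homMk_eq
    intro x z
    simp only [vanishes_iInf, vanishes_sup]
    constructor
    · rintro ⟨c, ⟨b, h1, h2⟩, h3⟩
      exact ⟨b, h1, c, h2, h3⟩
    · rintro ⟨b, h1, c, h2, h3⟩
      exact ⟨c, ⟨b, h1, h2⟩, h3⟩

/-- Strict relations on a partial equivalence relation. -/
structure IsStrictRel (A : PERU.{u}) (φ : A.carrier → I) : Prop where
  /-- `φ(x) ⊢ x ∼ x` -/
  strict : Entails φ (fun x => A.rel x x)
  /-- `φ(x) ∧ x ∼ x' ⊢ φ(x')` -/
  relational : Entails (fun p : A.carrier × A.carrier => φ p.1 ⊔ A.rel p.1 p.2) (fun p => φ p.2)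

/-- The partial equivalence relation `φ(x) ∧ x ∼ x'` given by a strict relation `φ`. -/
def restrict (A : PERU.{u}) (φ : A.carrier → I) (hφ : A.IsStrictRel φ) : PERU.{u} where
  carrier := A.carrier
  rel x x' := φ x ⊔ A.rel x x'
  symm := entails_iff_seq.mpr fun p hp => by
    rw [vanishes_sup] at hp ⊢
    exact ⟨hφ.relational.seq p (vanishes_sup.mpr hp), A.symm_seq hp.2⟩
  trans := entails_iff_seq.mpr fun p hp => by
    simp only [vanishes_sup] at hp ⊢
    exact ⟨hp.1.1, A.trans_seq hp.1.2 hp.2.2⟩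

/-- The inclusion into `A` of the restriction of `A` to a strict relation `φ`, represented by
`φ(x) ∧ x ∼ x'`. -/
noncomputable def restrictIncl (A : PERU.{u}) (φ : A.carrier → I) (hφ : A.IsStrictRel φ) :
    A.restrict φ hφ ⟶ A :=
  homMk (A := A.restrict φ hφ) (B := A) (fun x x' => φ x ⊔ A.rel x x') <| by
    have hs : ∀ x x' : ℕ → A.carrier, Vanishes (fun n => φ (x n)) →
        Vanishes (fun n => A.rel (x n) (x' n)) → Vanishes (fun n => φ (x' n)) :=
      fun x x' h h' => hφ.relational.seq (fun n => (x n, x' n)) (vanishes_sup.mpr ⟨h, h'⟩)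
    refine IsFunctional.of_seq ?_ ?_ ?_ ?_ <;> simp only [restrict, vanishes_sup]
    · rintro x y ⟨h, h'⟩
      exact ⟨⟨h, A.trans_seq h' (A.symm_seq h')⟩, A.trans_seq (A.symm_seq h') h'⟩
    · rintro x x' y y' ⟨h1, h2⟩ ⟨h3, h4⟩ h5
      exact ⟨hs _ _ h1 h4, A.trans_seq (A.symm_seq h4) (A.trans_seq h2 h5)⟩
    · rintro x y y' ⟨h1, h2⟩ ⟨h3, h4⟩
      exact A.trans_seq (A.symm_seq h2) h4
    · rintro x ⟨h1, h2⟩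
      exact ⟨x, h1, h2⟩

end PERU

/-! ## Complete metric spaces and continuous model theory -/

/-- Complete metric spaces of diameter at most 1 with underlying set in `Type u`. -/
structure CMet : Type (u + 1) where
  carrier : Type u
  [metric : MetricSpace carrier]
  [complete : CompleteSpace carrier]
  dist_le_one : ∀ x y : carrier, dist x y ≤ 1

attribute [instance] CMet.metric CMet.complete

namespace CMet

/-- Uniformly continuous maps. -/
@[ext]
structure Hom (X Y : CMet.{u}) : Type u where
  toFun : X.carrier → Y.carrier
  uniformContinuous : UniformContinuous toFun

/-- The category of complete metric spaces of diameter at most 1 and uniformly continuous maps. -/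
instance : Category.{u} CMet.{u} where
  Hom := Hom
  id X := ⟨fun x => x, uniformContinuous_id⟩
  comp f g := ⟨fun x => g.toFun (f.toFun x), g.uniformContinuous.comp f.uniformContinuous⟩

/-- The one-point space. -/
def point : CMet.{u} where
  carrier := PUnit.{u + 1}
  dist_le_one _ _ := by simp

/-- The product with the maximum metric. -/
def prod (X Y : CMet.{u}) : CMet.{u} where
  carrier := X.carrier × Y.carrier
  dist_le_one p q := by
    rw [Prod.dist_eq]
    exact max_le (X.dist_le_one _ _) (Y.dist_le_one _ _)

/-- The first projection. -/
def fst (X Y : CMet.{u}) : prod X Y ⟶ X :=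
  Hom.mk (X := prod X Y) (Y := X) Prod.fst uniformContinuous_fst

/-- The second projection. -/
def snd (X Y : CMet.{u}) : prod X Y ⟶ Y :=
  Hom.mk (X := prod X Y) (Y := Y) Prod.snd uniformContinuous_snd

theorem hom_ext {X Y : CMet.{u}} {f g : X ⟶ Y} (h : ∀ x, Hom.toFun f x = Hom.toFun g x) : f = g :=
  Hom.ext (funext h)

/-- The point is terminal. -/
def pointIsTerminal : IsTerminal point.{u} :=
  IsTerminal.ofUniqueHom (fun _ => ⟨fun _ => PUnit.unit, uniformContinuous_const⟩)
    (fun _ _ => hom_ext fun _ => rfl)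

/-- The product with the maximum metric is a categorical product. -/
def prodIsLimit (X Y : CMet.{u}) : IsLimit (BinaryFan.mk (fst X Y) (snd X Y)) :=
  BinaryFan.isLimitMk
    (fun s => Hom.mk (X := s.pt) (Y := prod X Y) (fun z => (s.fst.toFun z, s.snd.toFun z))
      (s.fst.uniformContinuous.prodMk s.snd.uniformContinuous))
    (fun _ => rfl) (fun _ => rfl)
    (fun s _ h₁ h₂ => hom_ext fun z => Prod.ext
      (congrArg (fun f : s.pt ⟶ X => Hom.toFun f z) h₁)
      (congrArg (fun f : s.pt ⟶ Y => Hom.toFun f z) h₂))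

instance : HasFiniteProducts CMet.{u} :=
  haveI : HasTerminal CMet.{u} := pointIsTerminal.hasTerminal
  haveI : HasBinaryProducts CMet.{u} :=
    haveI : ∀ X Y : CMet.{u}, HasLimit (pair X Y) := fun X Y => ⟨⟨_, prodIsLimit X Y⟩⟩
    hasBinaryProducts_of_hasLimit_pair _
  hasFiniteProducts_of_has_binary_and_terminal

end CMet

/-- The predicates of continuous model theory on `X`: uniformly continuous maps `X → [0,1]`. -/
def CMTPred (X : CMet.{u}) : Type u := {φ : X.carrier → I // UniformContinuous φ}

instance (X : CMet.{u}) : Preorder (CMTPred X) where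
  le φ ψ := Entails φ.1 ψ.1
  le_refl φ := Entails.refl φ.1
  le_trans _ _ _ h h' := Entails.trans h h'

/-- The indexed preorder `CMT` of continuous model theory, over spaces in `Type u`. -/
def CMT : IndexedPreorder CMet.{u} where
  Pred X := CMTPred X
  map f := ⟨fun φ => ⟨fun x => φ.1 (CMet.Hom.toFun f x),
      φ.2.comp (CMet.Hom.uniformContinuous f)⟩,
    fun _ _ (h : Entails _ _) ε hε => let ⟨δ, hδ, H⟩ := h ε hε; ⟨δ, hδ, fun _ => H _⟩⟩
  map_id _ α := ⟨le_refl α, le_refl α⟩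
  map_comp _ _ _ := ⟨Entails.refl _, Entails.refl _⟩

/-! ## The functor from complete metric spaces to partial equivalence relations -/

/-- The metric as a `[0,1]`-valued function. -/
def CMet.idist (X : CMet.{u}) (x y : X.carrier) : I := ⟨dist x y, dist_nonneg, X.dist_le_one x y⟩

theorem CMet.vanishes_triangle (X : CMet.{u}) {x y z : ℕ → X.carrier}
    (h : Vanishes fun n => X.idist (x n) (y n)) (h' : Vanishes fun n => X.idist (y n) (z n)) :
    Vanishes fun n => X.idist (x n) (z n) := by
  intro ε hε
  obtain ⟨N, hN⟩ := h (ε / 2) (by positivity)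
  obtain ⟨M, hM⟩ := h' (ε / 2) (by positivity)
  refine ⟨max N M, fun n hn => ?_⟩
  have h1 : dist (x n) (y n) ≤ ε / 2 := hN n (le_of_max_le_left hn)
  have h2 : dist (y n) (z n) ≤ ε / 2 := hM n (le_of_max_le_right hn)
  change dist (x n) (z n) ≤ ε
  linarith [dist_triangle (x n) (y n) (z n)]

theorem CMet.vanishes_symm (X : CMet.{u}) {x y : ℕ → X.carrier}
    (h : Vanishes fun n => X.idist (x n) (y n)) : Vanishes fun n => X.idist (y n) (x n) := by
  intro ε hε
  obtain ⟨N, hN⟩ := h ε hε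
  refine ⟨N, fun n hn => ?_⟩
  change dist (y n) (x n) ≤ ε
  rw [dist_comm]
  exact hN n hn

theorem CMet.vanishes_self (X : CMet.{u}) (x : ℕ → X.carrier) :
    Vanishes fun n => X.idist (x n) (x n) := fun ε hε => ⟨0, fun n _ => by
  change dist (x n) (x n) ≤ ε
  rw [dist_self]
  exact hε.le⟩

theorem CMet.vanishes_map {X Y : CMet.{u}} {f : X.carrier → Y.carrier} (hf : UniformContinuous f)
    {x x' : ℕ → X.carrier} (h : Vanishes fun n => X.idist (x n) (x' n)) :
    Vanishes fun n => Y.idist (f (x n)) (f (x' n)) := by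
  intro ε hε
  obtain ⟨δ, hδ, H⟩ := Metric.uniformContinuous_iff.mp hf ε hε
  obtain ⟨N, hN⟩ := h (δ / 2) (by positivity)
  refine ⟨N, fun n hn => ?_⟩
  have h1 : dist (x n) (x' n) ≤ δ / 2 := hN n hn
  exact (H (by linarith)).le

/-- The functor `G` on objects: `(X, d)` with `d` seen as an equivalence relation over `U`. -/
def CMet.toPER (X : CMet.{u}) : PERU.{u} where
  carrier := X.carrier
  rel := X.idist
  symm := entails_iff_seq.mpr fun _ hp => X.vanishes_symm hp
  trans := entails_iff_seq.mpr fun _ hp =>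
    X.vanishes_triangle (vanishes_sup.mp hp).1 (vanishes_sup.mp hp).2

theorem CMet.isFunctional_graph {X Y : CMet.{u}} {f : X.carrier → Y.carrier}
    (hf : UniformContinuous f) :
    PERU.IsFunctional X.toPER Y.toPER (fun x y => Y.idist (f x) y) :=
  PERU.IsFunctional.of_seq
    (fun x y _ => ⟨X.vanishes_self x, Y.vanishes_self y⟩)
    (fun _ _ _ _ h hx hy => Y.vanishes_triangle
      (CMet.vanishes_map hf (X.vanishes_symm hx)) (Y.vanishes_triangle h hy))
    (fun _ _ _ h h' => Y.vanishes_triangle (Y.vanishes_symm h) h')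
    (fun x _ => ⟨fun n => f (x n), Y.vanishes_self _⟩)

/-- The functor `G` from complete metric spaces to `PER(U)`: a uniformly continuous map `f` is sent
to the class of the functional relation `(x, y) ↦ d(f(x), y)`. -/
noncomputable def G : CMet.{u} ⥤ PERU.{u} where
  obj X := X.toPER
  map {X Y} f := PERU.homMk (A := X.toPER) (B := Y.toPER)
    (fun x y => Y.idist (CMet.Hom.toFun f x) y)
    (CMet.isFunctional_graph (CMet.Hom.uniformContinuous f))
  map_id _ := rfl
  map_comp {X Y Z} f g := by
    apply PERU.homMk_eq
    intro x z
    simp only [vanishes_iInf, vanishes_sup]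
    constructor
    · exact fun h => ⟨fun n => CMet.Hom.toFun f (x n), Y.vanishes_self _, h⟩
    · rintro ⟨y, h, h'⟩
      exact Z.vanishes_triangle (CMet.vanishes_map (CMet.Hom.uniformContinuous g) h) h'

theorem isStrictRel_of_uniformContinuous (X : CMet.{u}) (φ : CMTPred X) :
    (G.obj X).IsStrictRel φ.1 where
  strict := entails_iff_seq.mpr fun x _ => X.vanishes_self x
  relational := entails_iff_seq.mpr fun p hp => by
    obtain ⟨h1, h2⟩ := vanishes_sup.mp hp
    intro ε hε
    obtain ⟨δ, hδ, H⟩ := Metric.uniformContinuous_iff.mp φ.2 (ε / 2) (by positivity)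
    obtain ⟨N, hN⟩ := h1 (ε / 2) (by positivity)
    obtain ⟨M, hM⟩ := h2 (δ / 2) (by positivity)
    refine ⟨max N M, fun n hn => ?_⟩
    have h3 : (φ.1 (p n).1 : ℝ) ≤ ε / 2 := hN n (le_of_max_le_left hn)
    have h4 : dist (α := X.carrier) (p n).1 (p n).2 ≤ δ / 2 := hM n (le_of_max_le_right hn)
    have h5 : dist (φ.1 (p n).1) (φ.1 (p n).2) < ε / 2 := H (lt_of_le_of_lt h4 (by linarith))
    rw [Subtype.dist_eq, Real.dist_eq] at h5
    have := abs_lt.mp h5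
    change (φ.1 (p n).2 : ℝ) ≤ ε
    linarith

/-- The subobject of `G(X)` in `PER(U)` corresponding to a predicate `φ` on `X`, regarded as a
strict relation on `G(X)`. -/
noncomputable def predIncl (X : CMet.{u}) (φ : CMTPred X) :
    (G.obj X).restrict φ.1 (isStrictRel_of_uniformContinuous X φ) ⟶ G.obj X :=
  (G.obj X).restrictIncl φ.1 (isStrictRel_of_uniformContinuous X φ)

end ContLogic

open ContLogic

/-!
A morphism of `PER(U)` is conveniently thought of as a map on sequences. The order on
`[0,1]`-valued predicates satisfies `α ⊑ β` if and only if `β` tends to `0` along every sequence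
along which `α` does, so a functional relation `F` is determined by the pairs of sequences
`(x, y)` with `F(x n, y n) → 0` (`PERU.Tracks`), and it behaves like a map on admissible sequences
modulo asymptotic relatedness: `PERU.hom_ext_tracks`, `PERU.tracks_comp`. These sequences are
themselves morphisms out of one object `PERU.seqObj`, the generic admissible sequence
(`PERU.seqPt`), which turns categorical hypotheses into statements about sequences.

A minimum of finitely many sequences tends to `0` if and only if every subsequence has a further
subsequence along which one of them does. Hence the union of the images of a finite family is
everything precisely when every admissible sequence of the target has a subsequence that lifts to a
member of the family (`PERU.covers_iff`). In this form it is evident that coverings are stable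
under (weak) pullback and composition, and matching families glue (`PERU.exists_glue`), so that
there is a subcanonical topology `PERU.coherentTop`.

A subobject of a sheaf of types amounts to the closed subfunctor of its sections (`secs`).
Under this correspondence meets, reindexing and universal quantification are computed section by
section, while bottom, joins and images are the closures of the sectionwise operations; this gives
the logical structure of the subobjects in any topos of sheaves of types
(`subDoctrine_sheaf_isUniversallyCoherent`). On the side of metric spaces each
logical operation is likewise described by the sequences along which its value tends to `0`
(`CMTPred.isLUB_iff`, `CMTPred.isExists_iff`, `CMTPred.isForall_iff`, `CMTPred.isEq_iff`).

The functor `G` is faithful because distinct points have positive distance, and full because a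
sequence tracked by `F` from a constant sequence `x` is Cauchy, so that completeness provides a
point `y` with `F(x, y) = 0` (`exists_rep_eq_zero`). A section of `y(G(X))` over `U` is a morphism
`U ⟶ G(X)`, and it belongs to the subobject `predSub X φ` if and only if `φ` tends to `0` along all
the sequences that it takes as values (`mem_secs_predSub`). The two descriptions of the logical
operations, by sections and by sequences, are then compared. For bottom, joins and existential
quantifiers a section is restricted to the finite covering family provided by the subsequence
criterion; for the order and for universal quantifiers it is restricted to `seqObj`.
-/

namespace ContLogic

/-! ### Subobjects of sheaves as closed subfunctors -/

section SheafSubobjects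

open Opposite

variable {C : Type u} [Category.{v} C] {J : GrothendieckTopology C} {X Y Z : Sheaf J (Type w)}

/-- The sections of a subobject of a sheaf of types, as a subfunctor of the sheaf. -/
noncomputable abbrev secs (S : Subobject X) : Subfunctor X.obj :=
  Subfunctor.range S.arrow.hom

theorem isSheaf_obj (X : Sheaf J (Type w)) : Presieve.IsSheaf J X.obj :=
  (isSheaf_iff_isSheaf_of_type J _).mp X.2

theorem mono_hom (f : X ⟶ Y) [Mono f] : Mono f.hom :=
  (sheafToPresheaf J (Type w)).map_mono f

/-- The subobject of a sheaf generated by a family of sections: its sections are those which lie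
in the family locally. -/
noncomputable def subsheaf (T : Subfunctor X.obj) : Subobject X :=
  haveI : Mono (⟨(T.sheafify J).ι⟩ :
      (⟨(T.sheafify J).toFunctor, (isSheaf_iff_isSheaf_of_type J _).mpr
        (T.sheafify_isSheaf (isSheaf_obj X))⟩ : Sheaf J (Type w)) ⟶ X) :=
    (sheafToPresheaf J (Type w)).mono_of_mono_map (inferInstanceAs (Mono (T.sheafify J).ι))
  Subobject.mk (⟨(T.sheafify J).ι⟩ :
      (⟨(T.sheafify J).toFunctor, (isSheaf_iff_isSheaf_of_type J _).mpr
        (T.sheafify_isSheaf (isSheaf_obj X))⟩ : Sheaf J (Type w)) ⟶ X)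

theorem secs_mk (m : Y ⟶ X) [Mono m] : secs (Subobject.mk m) = Subfunctor.range m.hom := by
  apply le_antisymm
  · have h : (Subobject.mk m).arrow = (Subobject.underlyingIso m).hom ≫ m :=
      (Subobject.underlyingIso_hom_comp_eq_mk m).symm
    rw [secs, h]
    exact Subfunctor.range_comp_le _ _
  · have h : m = (Subobject.underlyingIso m).inv ≫ (Subobject.mk m).arrow :=
      (Subobject.underlyingIso_arrow m).symm
    conv_lhs => rw [h]
    exact Subfunctor.range_comp_le _ _

theorem secs_subsheaf (T : Subfunctor X.obj) : secs (subsheaf T) = T.sheafify J := by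
  rw [subsheaf, secs_mk]
  exact Subfunctor.range_ι _

instance isIso_toRange_arrow (S : Subobject X) : IsIso (Subfunctor.toRange S.arrow.hom) :=
  have := mono_hom S.arrow
  inferInstance

/-- A morphism of sheaves factors through a subobject as soon as its values do, since the
subobject is isomorphic to the subfunctor of its sections. -/
theorem factors_iff_range_le (S : Subobject X) (f : Y ⟶ X) :
    S.Factors f ↔ Subfunctor.range f.hom ≤ secs S := by
  constructor
  · intro h
    conv_lhs => rw [← S.factorThru_arrow f h]
    exact Subfunctor.range_comp_le _ _
  · intro h
    have h1 : inv (Subfunctor.toRange S.arrow.hom) ≫ S.arrow.hom =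
        (Subfunctor.range S.arrow.hom).ι := by
      rw [IsIso.inv_comp_eq]
      rfl
    let g : Y ⟶ (S : Sheaf J (Type w)) :=
      ⟨Subfunctor.lift f.hom h ≫ inv (Subfunctor.toRange S.arrow.hom)⟩
    have hg : g ≫ S.arrow = f := by
      ext1
      change (Subfunctor.lift f.hom h ≫ inv (Subfunctor.toRange S.arrow.hom)) ≫ S.arrow.hom =
        f.hom
      rw [Category.assoc, h1]
      rfl
    rw [← hg]
    exact Subobject.factors_comp_arrow g

theorem secs_le_secs {S T : Subobject X} : secs S ≤ secs T ↔ S ≤ T := by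
  rw [secs, ← factors_iff_range_le]
  exact ⟨Subobject.le_of_factors, fun h => Subobject.factors_of_le _ h S.factors_self⟩

theorem secs_injective {S T : Subobject X} (h : secs S = secs T) : S = T :=
  le_antisymm (secs_le_secs.mp h.le) (secs_le_secs.mp h.ge)

/-- The sections of a subobject form a closed subfunctor: belonging to a subobject is a local
property. -/
theorem sheafify_secs (S : Subobject X) : (secs S).sheafify J = secs S := by
  refine ((Subfunctor.eq_sheafify_iff _ (isSheaf_obj X)).mpr ?_).symm
  exact Presieve.isSheaf_iso J (asIso (Subfunctor.toRange S.arrow.hom)) (isSheaf_obj _)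

theorem sheafify_mono {F : Cᵒᵖ ⥤ Type w} {T T' : Subfunctor F} (h : T ≤ T') :
    T.sheafify J ≤ T'.sheafify J :=
  fun _ _ hx => J.superset_covering (fun V _ hi => h (op V) hi) hx

/-- Generating a subobject is left adjoint to taking sections. -/
theorem subsheaf_le_iff {T : Subfunctor X.obj} {S : Subobject X} :
    subsheaf T ≤ S ↔ T ≤ secs S := by
  rw [← secs_le_secs, secs_subsheaf]
  exact ⟨(T.le_sheafify J).trans, fun h => (sheafify_mono h).trans (sheafify_secs S).le⟩

theorem sheafify_inf {F : Cᵒᵖ ⥤ Type w} (T T' : Subfunctor F) :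
    (T ⊓ T').sheafify J = T.sheafify J ⊓ T'.sheafify J :=
  le_antisymm (le_inf (sheafify_mono inf_le_left) (sheafify_mono inf_le_right))
    fun _ _ hx => J.superset_covering (le_refl (_ ⊓ _ : Sieve _)) (J.intersection_covering hx.1 hx.2)

theorem sheafify_preimage {F F' : Cᵒᵖ ⥤ Type w} (T : Subfunctor F) (f : F' ⟶ F) :
    (T.preimage f).sheafify J = (T.sheafify J).preimage f := by
  have key : ∀ (U : Cᵒᵖ) (x : F'.obj U),
      (T.preimage f).sieveOfSection x = T.sieveOfSection (f.app U x) := by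
    intro U x
    ext V i
    change f.app (op V) (F'.map i.op x) ∈ T.obj (op V) ↔ F.map i.op (f.app U x) ∈ T.obj (op V)
    rw [NatTrans.naturality_apply]
  ext U x
  change (T.preimage f).sieveOfSection x ∈ J _ ↔ T.sieveOfSection (f.app U x) ∈ J _
  rw [key]

theorem secs_pullback (f : Y ⟶ X) (S : Subobject X) :
    secs ((Subobject.pullback f).obj S) = (secs S).preimage f.hom := by
  apply le_antisymm
  · rintro U _ ⟨y, rfl⟩
    refine ⟨(Subobject.pullbackπ f S).hom.app U y, ?_⟩
    have := (Subobject.isPullback f S).w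
    exact congrArg (fun g => g.hom.app U y) this
  · rw [← subsheaf_le_iff]
    have hf : S.Factors ((subsheaf ((secs S).preimage f.hom)).arrow ≫ f) := by
      rw [factors_iff_range_le]
      rintro U _ ⟨y, rfl⟩
      have hy : (subsheaf ((secs S).preimage f.hom)).arrow.hom.app U y ∈
          (secs (subsheaf ((secs S).preimage f.hom))).obj U := ⟨y, rfl⟩
      rw [secs_subsheaf, sheafify_preimage, sheafify_secs] at hy
      exact hy
    refine Subobject.le_of_comm ((Subobject.isPullback f S).lift (S.factorThru _ hf)
      (subsheaf ((secs S).preimage f.hom)).arrow (by simp)) (by simp)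

/-! ### The order structure on subobjects of a sheaf -/

theorem isTop_iff_secs (S : Subobject X) : IsTop S ↔ secs S = ⊤ := by
  refine ⟨fun h => top_le_iff.mp ?_, fun h T => secs_le_secs.mp (h ▸ le_top)⟩
  exact subsheaf_le_iff.mp (h _)

theorem isBot_iff_secs (S : Subobject X) :
    IsBot S ↔ secs S = (⊥ : Subfunctor X.obj).sheafify J := by
  have h0 : IsBot (subsheaf (⊥ : Subfunctor X.obj)) := fun T => subsheaf_le_iff.mpr bot_le
  refine ⟨fun h => ?_, fun h => ?_⟩
  · rw [le_antisymm (h _) (h0 S), secs_subsheaf]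
  · rwa [secs_injective (h.trans (secs_subsheaf _).symm)]

theorem isGLB_iff_secs (S T M : Subobject X) :
    IsGLB {S, T} M ↔ secs M = secs S ⊓ secs T := by
  have h0 : IsGLB {S, T} (subsheaf (secs S ⊓ secs T)) := by
    rw [isGLB_iff_le_iff]
    intro N
    simp [lowerBounds_insert, ← secs_le_secs, secs_subsheaf, sheafify_inf, sheafify_secs]
  have h1 := secs_subsheaf (J := J) (secs S ⊓ secs T)
  rw [sheafify_inf, sheafify_secs, sheafify_secs] at h1
  refine ⟨fun h => by rw [h.unique h0, h1], fun h => ?_⟩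
  rwa [secs_injective (h.trans h1.symm)]

theorem isLUB_iff_secs (S T M : Subobject X) :
    IsLUB {S, T} M ↔ secs M = (secs S ⊔ secs T).sheafify J := by
  have h0 : IsLUB {S, T} (subsheaf (secs S ⊔ secs T)) := by
    rw [isLUB_iff_le_iff]
    intro N
    rw [subsheaf_le_iff]
    simp [upperBounds_insert, ← secs_le_secs]
  refine ⟨fun h => by rw [h.unique h0, secs_subsheaf], fun h => ?_⟩
  rwa [secs_injective (h.trans (secs_subsheaf _).symm)]

/-- The image of a subobject consists of the sections that are locally images. -/
theorem isExists_iff_secs (f : Y ⟶ X) (S : Subobject Y) (E : Subobject X) :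
    (∀ B : Subobject X, E ≤ B ↔ S ≤ (Subobject.pullback f).obj B) ↔
      secs E = ((secs S).image f.hom).sheafify J := by
  have h0 : ∀ B : Subobject X, subsheaf ((secs S).image f.hom) ≤ B ↔
      S ≤ (Subobject.pullback f).obj B := by
    intro B
    rw [subsheaf_le_iff, ← secs_le_secs, secs_pullback, Subfunctor.image_le_iff]
  refine ⟨fun h => ?_, fun h => ?_⟩
  · rw [le_antisymm ((h _).mpr ((h0 _).mp le_rfl)) ((h0 _).mpr ((h _).mp le_rfl)), secs_subsheaf]
  · rwa [secs_injective (h.trans (secs_subsheaf _).symm)]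

/-- The sections `x` of `X` such that every local section of `Y` over `x` lies in `T`. -/
def forallSubfunctor (f : Y ⟶ X) (T : Subfunctor Y.obj) : Subfunctor X.obj where
  obj U := {x | ∀ (V : Cᵒᵖ) (i : U ⟶ V) (y : Y.obj.obj V),
    f.hom.app V y = X.obj.map i x → y ∈ T.obj V}
  map {U V} i x hx W j y hy := hx W (i ≫ j) y (by rw [hy, Functor.map_comp]; rfl)

theorem le_forallSubfunctor_iff (f : Y ⟶ X) (T : Subfunctor Y.obj) (B : Subfunctor X.obj) :
    B ≤ forallSubfunctor f T ↔ B.preimage f.hom ≤ T := by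
  constructor
  · intro h U y hy
    exact h U hy U (𝟙 U) y (by simp)
  · intro h U x hx V i y hy
    refine h V ?_
    change f.hom.app V y ∈ B.obj V
    rw [hy]
    exact B.map i hx

/-- The subfunctor of those `x` over which everything lies in a subobject is already closed, since
it is right adjoint to taking preimages, which commutes with sheafification. -/
theorem sheafify_forallSubfunctor (f : Y ⟶ X) (S : Subobject Y) :
    (forallSubfunctor f (secs S)).sheafify J = forallSubfunctor f (secs S) := by
  refine le_antisymm ?_ (Subfunctor.le_sheafify _ _)
  rw [le_forallSubfunctor_iff, ← sheafify_preimage, ← sheafify_secs S]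
  refine sheafify_mono ?_
  rw [sheafify_secs, ← le_forallSubfunctor_iff]

/-- Unlike the other operations, universal quantification needs no sheafification. -/
theorem isForall_iff_secs (f : Y ⟶ X) (S : Subobject Y) (A : Subobject X) :
    (∀ B : Subobject X, B ≤ A ↔ (Subobject.pullback f).obj B ≤ S) ↔
      secs A = forallSubfunctor f (secs S) := by
  have h1 := sheafify_forallSubfunctor f S
  have h0 : ∀ B : Subobject X, B ≤ subsheaf (forallSubfunctor f (secs S)) ↔
      (Subobject.pullback f).obj B ≤ S := by
    intro B
    rw [← secs_le_secs, ← secs_le_secs, secs_pullback, secs_subsheaf, h1, le_forallSubfunctor_iff]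
  refine ⟨fun h => ?_, fun h => ?_⟩
  · rw [le_antisymm ((h0 _).mpr ((h _).mp le_rfl)) ((h _).mpr ((h0 _).mp le_rfl)), secs_subsheaf,
      h1]
  · rwa [secs_injective (h.trans (h1.symm.trans (secs_subsheaf _).symm))]

/-! ### Finite limits of sheaves, sectionwise -/

theorem prod_section_ext {U : Cᵒᵖ} {a b : (X ⨯ Y : Sheaf J (Type w)).obj.obj U}
    (h₁ : (prod.fst : X ⨯ Y ⟶ X).hom.app U a = (prod.fst : X ⨯ Y ⟶ X).hom.app U b)
    (h₂ : (prod.snd : X ⨯ Y ⟶ Y).hom.app U a = (prod.snd : X ⨯ Y ⟶ Y).hom.app U b) : a = b := by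
  refine Concrete.isLimit_ext _ (isLimitOfPreserves
    (sheafToPresheaf J (Type w) ⋙ (evaluation _ _).obj U) (limit.isLimit (pair X Y))) _ _ ?_
  rintro ⟨_ | _⟩
  · exact h₁
  · exact h₂

theorem exists_section_of_isPullback {A B D E : Sheaf J (Type w)} {π : A ⟶ B} {f : A ⟶ D}
    {g : B ⟶ E} {π' : D ⟶ E} (sq : IsPullback π f g π') {U : Cᵒᵖ} (b : B.obj.obj U)
    (d : D.obj.obj U) (h : g.hom.app U b = π'.hom.app U d) :
    ∃ a : A.obj.obj U, π.hom.app U a = b ∧ f.hom.app U a = d :=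
  Types.exists_of_isPullback
    (sq.map (sheafToPresheaf J (Type w) ⋙ (evaluation _ _).obj U)) b d h

theorem mem_range_diag_iff (X : Sheaf J (Type w)) (U : Cᵒᵖ)
    (z : (X ⨯ X : Sheaf J (Type w)).obj.obj U) :
    z ∈ (Subfunctor.range (diag X).hom).obj U ↔
      (prod.fst : X ⨯ X ⟶ X).hom.app U z = (prod.snd : X ⨯ X ⟶ X).hom.app U z := by
  have hfst : ∀ x, (prod.fst : X ⨯ X ⟶ X).hom.app U ((diag X).hom.app U x) = x := fun x =>
    congrArg (fun g => g.hom.app U x) (prod.lift_fst (𝟙 X) (𝟙 X))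
  have hsnd : ∀ x, (prod.snd : X ⨯ X ⟶ X).hom.app U ((diag X).hom.app U x) = x := fun x =>
    congrArg (fun g => g.hom.app U x) (prod.lift_snd (𝟙 X) (𝟙 X))
  constructor
  · rintro ⟨x, rfl⟩
    rw [hfst, hsnd]
  · exact fun h => ⟨(prod.fst : X ⨯ X ⟶ X).hom.app U z,
      prod_section_ext (hfst _) ((hsnd _).trans h)⟩

/-- The equality predicate is the diagonal. -/
theorem isEq_iff_secs (e : Subobject (X ⨯ X)) :
    (∀ A : Subobject (X ⨯ X), IsTop ((Subobject.pullback (diag X)).obj A) ↔ e ≤ A) ↔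
      ∀ U z, z ∈ (secs e).obj U ↔ (prod.fst : X ⨯ X ⟶ X).hom.app U z =
        (prod.snd : X ⨯ X ⟶ X).hom.app U z := by
  have h0 : ∀ A : Subobject (X ⨯ X),
      IsTop ((Subobject.pullback (diag X)).obj A) ↔ Subobject.mk (diag X) ≤ A := by
    intro A
    rw [isTop_iff_secs, secs_pullback, Subfunctor.preimage_eq_top_iff, ← secs_mk, secs_le_secs]
  have h2 : secs (Subobject.mk (diag X)) = Subfunctor.range (diag X).hom := secs_mk _
  refine ⟨fun h => ?_, fun h => ?_⟩
  · rw [le_antisymm ((h _).mp ((h0 _).mpr le_rfl)) ((h0 _).mp ((h _).mpr le_rfl)), h2]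
    exact mem_range_diag_iff X
  · have : e = Subobject.mk (diag X) := secs_injective (by
      rw [h2]
      ext U z
      rw [h, mem_range_diag_iff])
    rwa [this]

/-! ### The subobject doctrine of a sheaf category -/

theorem isDistPrelattice_subobject (X : Sheaf J (Type w)) : IsDistPrelattice (Subobject X) where
  exists_top := ⟨subsheaf ⊤, fun T => secs_le_secs.mp (by
    rw [secs_subsheaf]; exact le_top.trans (Subfunctor.le_sheafify _ _))⟩
  exists_bot := ⟨subsheaf ⊥, fun T => subsheaf_le_iff.mpr bot_le⟩
  exists_meet S T := ⟨subsheaf (secs S ⊓ secs T), by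
    rw [isGLB_iff_secs, secs_subsheaf, sheafify_inf, sheafify_secs, sheafify_secs]⟩
  exists_join S T := ⟨subsheaf (secs S ⊔ secs T), by rw [isLUB_iff_secs, secs_subsheaf]⟩
  distrib a b c bc a_bc ab ac h1 h2 h3 h4 := by
    rw [isLUB_iff_secs] at h1 ⊢
    rw [isGLB_iff_secs] at h2 h3 h4
    rw [h2, h1, h3, h4, inf_comm (secs a), inf_comm (secs a), inf_comm (secs a),
      ← Subfunctor.max_min, sheafify_inf, sheafify_secs]

theorem isPrelatticeHom_pullback (f : X ⟶ Y) :
    IsPrelatticeHom (Subobject.pullback f).obj where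
  monotone := (Subobject.pullback f).monotone
  map_top t h := by
    rw [isTop_iff_secs] at h ⊢
    rw [secs_pullback, h]; rfl
  map_bot t h := by
    rw [isBot_iff_secs] at h ⊢
    rw [secs_pullback, h, ← sheafify_preimage]; rfl
  map_meet a b m h := by
    rw [isGLB_iff_secs] at h ⊢
    rw [secs_pullback, secs_pullback, secs_pullback, h]; rfl
  map_join a b m h := by
    rw [isLUB_iff_secs] at h ⊢
    rw [secs_pullback, secs_pullback, secs_pullback, h, ← sheafify_preimage]; rfl

theorem secs_eq_prod {A B : Sheaf J (Type w)} (eA : Subobject (A ⨯ A)) (eB : Subobject (B ⨯ B))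
    (eAB : Subobject ((A ⨯ B) ⨯ (A ⨯ B)))
    (hA : ∀ U z, z ∈ (secs eA).obj U ↔ (prod.fst : A ⨯ A ⟶ A).hom.app U z =
        (prod.snd : A ⨯ A ⟶ A).hom.app U z)
    (hB : ∀ U z, z ∈ (secs eB).obj U ↔ (prod.fst : B ⨯ B ⟶ B).hom.app U z =
        (prod.snd : B ⨯ B ⟶ B).hom.app U z)
    (hAB : ∀ U z, z ∈ (secs eAB).obj U ↔ (prod.fst : (A ⨯ B) ⨯ (A ⨯ B) ⟶ _).hom.app U z =
        (prod.snd : (A ⨯ B) ⨯ (A ⨯ B) ⟶ _).hom.app U z) :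
    secs eAB =
      (secs eA).preimage
        (prod.map (prod.fst : A ⨯ B ⟶ A) (prod.fst : A ⨯ B ⟶ A)).hom ⊓
      (secs eB).preimage
        (prod.map (prod.snd : A ⨯ B ⟶ B) (prod.snd : A ⨯ B ⟶ B)).hom := by
  ext U z
  have e1 := congrArg (fun g => g.hom.app U z)
    (prod.map_fst (prod.fst : A ⨯ B ⟶ A) (prod.fst : A ⨯ B ⟶ A))
  have e2 := congrArg (fun g => g.hom.app U z)
    (prod.map_snd (prod.fst : A ⨯ B ⟶ A) (prod.fst : A ⨯ B ⟶ A))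
  have e3 := congrArg (fun g => g.hom.app U z)
    (prod.map_fst (prod.snd : A ⨯ B ⟶ B) (prod.snd : A ⨯ B ⟶ B))
  have e4 := congrArg (fun g => g.hom.app U z)
    (prod.map_snd (prod.snd : A ⨯ B ⟶ B) (prod.snd : A ⨯ B ⟶ B))
  rw [hAB]
  refine Iff.trans ?_ (and_congr (hA U _) (hB U _)).symm
  constructor
  · intro h
    exact ⟨e1.trans ((congrArg ((prod.fst : A ⨯ B ⟶ A).hom.app U) h).trans e2.symm),
      e3.trans ((congrArg ((prod.snd : A ⨯ B ⟶ B).hom.app U) h).trans e4.symm)⟩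
  · rintro ⟨h, h'⟩
    exact prod_section_ext (e1.symm.trans (h.trans e2)) (e3.symm.trans (h'.trans e4))

theorem preimage_image_of_isPullback {A B D E : Sheaf J (Type w)} {π : A ⟶ B} {f : A ⟶ D}
    {g : B ⟶ E} {π' : D ⟶ E} (sq : IsPullback π f g π') (T : Subfunctor D.obj) :
    (T.image π'.hom).preimage g.hom = (T.preimage f.hom).image π.hom := by
  ext U b
  constructor
  · rintro ⟨d, hd, h⟩
    obtain ⟨a, rfl, rfl⟩ := exists_section_of_isPullback sq b d h.symm
    exact ⟨a, hd, rfl⟩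
  · rintro ⟨a, ha, rfl⟩
    exact ⟨f.hom.app U a, ha, (congrArg (fun g => g.hom.app U a) sq.w).symm⟩

theorem preimage_forallSubfunctor_of_isPullback {A B D E : Sheaf J (Type w)} {π : A ⟶ B}
    {f : A ⟶ D} {g : B ⟶ E} {π' : D ⟶ E} (sq : IsPullback π f g π') (T : Subfunctor D.obj) :
    (forallSubfunctor π' T).preimage g.hom = forallSubfunctor π (T.preimage f.hom) := by
  ext U b
  constructor
  · intro h V i a ha
    refine h V i (f.hom.app V a) ?_
    refine (congrArg (fun g => g.hom.app V a) sq.w).symm.trans ?_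
    change g.hom.app V (π.hom.app V a) = _
    rw [ha, NatTrans.naturality_apply]
  · intro h V i d hd
    rw [← NatTrans.naturality_apply] at hd
    obtain ⟨a, ha, rfl⟩ := exists_section_of_isPullback sq _ d hd.symm
    exact h V i a ha

theorem inf_image {F F' : Cᵒᵖ ⥤ Type w} (f : F' ⟶ F) (T : Subfunctor F) (T' : Subfunctor F') :
    T ⊓ T'.image f = (T.preimage f ⊓ T').image f := by
  ext U x
  constructor
  · rintro ⟨hx, y, hy, rfl⟩
    exact ⟨y, ⟨hx, hy⟩, rfl⟩
  · rintro ⟨y, ⟨hx, hy⟩, rfl⟩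
    exact ⟨hx, y, hy, rfl⟩

theorem subDoctrine_sheaf_isUniversallyCoherent (J : GrothendieckTopology C) :
    (subDoctrine (Sheaf J (Type w))).IsUniversallyCoherent where
  distPrelattice X := isDistPrelattice_subobject X
  prelatticeHom f := isPrelatticeHom_pullback f
  exists_eq X := ⟨Subobject.mk (diag X), (isEq_iff_secs (Subobject.mk (diag X))).mpr
    fun U z => by rw [secs_mk, mem_range_diag_iff]⟩
  eq_prod A B := fun (eA : Subobject _) (eB : Subobject _) (eAB : Subobject _) hA hB hAB => by
    have h := secs_eq_prod eA eB eAB ((isEq_iff_secs _).mp hA) ((isEq_iff_secs _).mp hB)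
      ((isEq_iff_secs _).mp hAB)
    rw [← secs_pullback, ← secs_pullback, ← isGLB_iff_secs] at h
    exact h
  exists_exists {Y X} π _ α := ⟨subsheaf ((secs (X := Y) α).image π.hom),
    (isExists_iff_secs π α _).mpr (secs_subsheaf _)⟩
  exists_forall {Y X} π _ α := ⟨subsheaf (forallSubfunctor π (secs (X := Y) α)),
    (isForall_iff_secs π α _).mpr ((secs_subsheaf _).trans (sheafify_forallSubfunctor π α))⟩
  frobenius {Y X} π _ := fun (α : Subobject X) (β : Subobject Y) (e m : Subobject X)
      (k : Subobject Y) he hm hk => by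
    have he := (isExists_iff_secs π β e).mp he
    have hm := (isGLB_iff_secs (X := X) α e m).mp hm
    have hk := (isGLB_iff_secs ((Subobject.pullback π).obj α) β k).mp hk
    refine (isExists_iff_secs π k m).mpr ?_
    rw [secs_pullback] at hk
    rw [hm, he, hk, ← inf_image, sheafify_inf, sheafify_secs]
  beckChevalley_exists π f g π' sq _ _ := fun (α : Subobject _) (e : Subobject _) he => by
    have he := (isExists_iff_secs π' α e).mp he
    refine (isExists_iff_secs π ((Subobject.pullback f).obj α)
      ((Subobject.pullback g).obj e)).mpr ?_
    rw [secs_pullback, secs_pullback, he, ← sheafify_preimage, preimage_image_of_isPullback sq]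
  beckChevalley_forall π f g π' sq _ _ := fun (α : Subobject _) (e : Subobject _) he => by
    have he := (isForall_iff_secs π' α e).mp he
    refine (isForall_iff_secs π ((Subobject.pullback f).obj α)
      ((Subobject.pullback g).obj e)).mpr ?_
    rw [secs_pullback, secs_pullback, he, preimage_forallSubfunctor_of_isPullback sq]

end SheafSubobjects

/-! ### Vanishing sequences and subsequences -/

section Sequences

open Filter

theorem Vanishes.comp {a : ℕ → I} (h : Vanishes a) {k : ℕ → ℕ} (hk : Tendsto k atTop atTop) :
    Vanishes (fun n => a (k n)) := by
  intro ε hε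
  obtain ⟨N, hN⟩ := h ε hε
  obtain ⟨M, hM⟩ := eventually_atTop.mp (hk.eventually_ge_atTop N)
  exact ⟨M, fun n hn => hN _ (hM n hn)⟩

theorem Vanishes.subseq {a : ℕ → I} (h : Vanishes a) {s : ℕ → ℕ} (hs : StrictMono s) :
    Vanishes (fun n => a (s n)) :=
  h.comp hs.tendsto_atTop

theorem Vanishes.mono {a b : ℕ → I} (h : Vanishes a) (hab : ∀ n, b n ≤ a n) : Vanishes b := by
  intro ε hε
  obtain ⟨N, hN⟩ := h ε hε
  exact ⟨N, fun n hn => le_trans (hab n : (b n : ℝ) ≤ a n) (hN n hn)⟩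

/-- A sequence tends to `0` if each of its subsequences has a subsequence that does. -/
theorem vanishes_of_subseq {a : ℕ → I}
    (h : ∀ s : ℕ → ℕ, StrictMono s → ∃ t : ℕ → ℕ, StrictMono t ∧ Vanishes fun n => a (s (t n))) :
    Vanishes a := by
  intro ε hε
  by_contra hc
  push Not at hc
  obtain ⟨s, hs, hs'⟩ := extraction_of_frequently_atTop
    (frequently_atTop.mpr fun N => hc N : ∃ᶠ n in atTop, ε < (a n : ℝ))
  obtain ⟨t, -, ht⟩ := h s hs
  obtain ⟨N, hN⟩ := ht ε hε
  exact absurd (hN N le_rfl) (not_le.mpr (hs' _))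

theorem exists_strictMono_const {ι : Type*} [Finite ι] (i : ℕ → ι) :
    ∃ (j : ι) (s : ℕ → ℕ), StrictMono s ∧ ∀ n, i (s n) = j := by
  obtain ⟨j, hj⟩ := Finite.exists_infinite_fiber i
  obtain ⟨s, hs, hs'⟩ := extraction_of_frequently_atTop
    (Nat.frequently_atTop_iff_infinite.mpr (Set.infinite_coe_iff.mp hj))
  exact ⟨j, s, hs, hs'⟩

/-- If the minimum of finitely many sequences vanishes, then one of them vanishes along a
subsequence. -/
theorem exists_vanishes_of_iInf {ι : Type u} [Finite ι] {b : ℕ → ι → I}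
    (h : Vanishes fun n => ⨅ i, b n i) :
    ∃ (i : ι) (s : ℕ → ℕ), StrictMono s ∧ Vanishes fun n => b (s n) i := by
  obtain ⟨i, hi⟩ := vanishes_iInf.mp h
  obtain ⟨j, s, hs, hj⟩ := exists_strictMono_const i
  refine ⟨j, s, hs, ?_⟩
  have := hi.subseq hs
  simpa only [hj] using this

/-- A consequence of each of finitely many conditions is a consequence of their disjunction. -/
theorem vanishes_of_iInf {ι : Type u} [Finite ι] {b : ℕ → ι → I} {a : ℕ → I}
    (h : Vanishes fun n => ⨅ i, b n i)
    (H : ∀ (i : ι) (s : ℕ → ℕ), StrictMono s → Vanishes (fun n => b (s n) i) →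
      Vanishes fun n => a (s n)) : Vanishes a := by
  refine vanishes_of_subseq fun s hs => ?_
  obtain ⟨i, t, ht, hi⟩ := exists_vanishes_of_iInf (h.subseq hs)
  exact ⟨t, ht, H i (fun n => s (t n)) (hs.comp ht) hi⟩

theorem vanishes_iInf_of_vanishes {ι : Type u} {b : ℕ → ι → I} (i : ι)
    (h : Vanishes fun n => b n i) : Vanishes fun n => ⨅ i, b n i :=
  h.mono fun n => iInf_le (b n) i

/-- The sequence `1 / (n + 1)`. -/
noncomputable def invSucc (n : ℕ) : I :=
  ⟨1 / ((n : ℝ) + 1), by positivity, by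
    rw [div_le_one (by positivity)]; linarith [Nat.cast_nonneg (α := ℝ) n]⟩

theorem vanishes_invSucc : Vanishes invSucc := by
  intro ε hε
  obtain ⟨N, hN⟩ := exists_nat_one_div_lt hε
  refine ⟨N, fun n hn => le_trans ?_ hN.le⟩
  change 1 / ((n : ℝ) + 1) ≤ _
  have : (N : ℝ) ≤ n := by exact_mod_cast hn
  gcongr

theorem tendsto_of_vanishes_invSucc {k : ℕ → ℕ} (h : Vanishes fun n => invSucc (k n)) :
    Tendsto k atTop atTop := by
  rw [tendsto_atTop]
  intro b
  obtain ⟨N, hN⟩ := h (1 / ((b : ℝ) + 1)) (by positivity)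
  refine eventually_atTop.mpr ⟨N, fun n hn => ?_⟩
  have h1 : 1 / ((k n : ℝ) + 1) ≤ 1 / ((b : ℝ) + 1) := hN n hn
  rw [one_div_le_one_div (by positivity) (by positivity)] at h1
  have h2 : (b : ℝ) ≤ k n := by linarith
  exact_mod_cast h2

end Sequences

/-! ### Morphisms of partial equivalence relations acting on sequences -/

namespace PERU

variable {A B C X Y : PERU.{u}}

/-- A functional relation representing a morphism. -/
noncomputable def rep (f : A ⟶ B) : A.carrier → B.carrier → I :=
  (Quotient.out (s := funSetoid A B) f).1

theorem isFunctional_rep (f : A ⟶ B) : IsFunctional A B (rep f) :=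
  (Quotient.out (s := funSetoid A B) f).2

/-- A sequence is admissible if it eventually lies in the domain of `∼`. -/
def Adm (A : PERU.{u}) (x : ℕ → A.carrier) : Prop :=
  Vanishes fun n => A.rel (x n) (x n)

/-- Two sequences are asymptotically related. -/
def SeqRel (A : PERU.{u}) (x y : ℕ → A.carrier) : Prop :=
  Vanishes fun n => A.rel (x n) (y n)

/-- `f` sends the sequence `x` to the sequence `y`. Since this holds or fails simultaneously for
all relations representing `f`, morphisms may be computed with as if they were maps on classes of
admissible sequences modulo `SeqRel`. -/
def Tracks (f : A ⟶ B) (x : ℕ → A.carrier) (y : ℕ → B.carrier) : Prop :=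
  Vanishes fun n => rep f (x n) (y n)

theorem SeqRel.symm {x y : ℕ → A.carrier} (h : A.SeqRel x y) : A.SeqRel y x :=
  A.symm_seq h

theorem SeqRel.trans {x y z : ℕ → A.carrier} (h : A.SeqRel x y) (h' : A.SeqRel y z) :
    A.SeqRel x z :=
  A.trans_seq h h'

theorem SeqRel.left {x y : ℕ → A.carrier} (h : A.SeqRel x y) : A.Adm x :=
  h.trans h.symm

theorem SeqRel.right {x y : ℕ → A.carrier} (h : A.SeqRel x y) : A.Adm y :=
  h.symm.trans h

theorem Tracks.left {f : A ⟶ B} {x : ℕ → A.carrier} {y : ℕ → B.carrier} (h : Tracks f x y) :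
    A.Adm x :=
  ((isFunctional_rep f).strict_seq h).1

theorem Tracks.right {f : A ⟶ B} {x : ℕ → A.carrier} {y : ℕ → B.carrier} (h : Tracks f x y) :
    B.Adm y :=
  ((isFunctional_rep f).strict_seq h).2

theorem Tracks.congr {f : A ⟶ B} {x x' : ℕ → A.carrier} {y y' : ℕ → B.carrier}
    (h : Tracks f x y) (hx : A.SeqRel x x') (hy : B.SeqRel y y') : Tracks f x' y' :=
  (isFunctional_rep f).relational_seq h hx hy

theorem Tracks.unique {f : A ⟶ B} {x : ℕ → A.carrier} {y y' : ℕ → B.carrier}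
    (h : Tracks f x y) (h' : Tracks f x y') : B.SeqRel y y' :=
  (isFunctional_rep f).singleValued_seq h h'

theorem exists_tracks (f : A ⟶ B) {x : ℕ → A.carrier} (hx : A.Adm x) : ∃ y, Tracks f x y :=
  (isFunctional_rep f).total_seq hx

theorem Tracks.subseq {f : A ⟶ B} {x : ℕ → A.carrier} {y : ℕ → B.carrier} (h : Tracks f x y)
    {s : ℕ → ℕ} (hs : StrictMono s) : Tracks f (fun n => x (s n)) (fun n => y (s n)) :=
  Vanishes.subseq h hs

theorem Adm.subseq {x : ℕ → A.carrier} (h : A.Adm x) {s : ℕ → ℕ} (hs : StrictMono s) :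
    A.Adm (fun n => x (s n)) :=
  Vanishes.subseq h hs

theorem tracks_homMk {F : A.carrier → B.carrier → I} (hF : IsFunctional A B F)
    (x : ℕ → A.carrier) (y : ℕ → B.carrier) :
    Tracks (homMk F hF : A ⟶ B) x y ↔ Vanishes fun n => F (x n) (y n) := by
  have h := Quotient.mk_out (s := funSetoid A B) ⟨F, hF⟩
  exact ⟨h.1.seq fun n => (x n, y n), h.2.seq fun n => (x n, y n)⟩

theorem homMk_rep (f : A ⟶ B) : homMk (rep f) (isFunctional_rep f) = f :=
  Quotient.out_eq (s := funSetoid A B) f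

theorem tracks_id (x y : ℕ → A.carrier) : Tracks (𝟙 A) x y ↔ A.SeqRel x y :=
  tracks_homMk (IsFunctional.id A) x y

theorem tracks_comp (f : A ⟶ B) (g : B ⟶ C) (x : ℕ → A.carrier) (z : ℕ → C.carrier) :
    Tracks (f ≫ g) x z ↔ ∃ y, Tracks f x y ∧ Tracks g y z := by
  have h : f ≫ g = homMk _ ((isFunctional_rep f).comp (isFunctional_rep g)) := by
    conv_lhs => rw [← homMk_rep f, ← homMk_rep g]
    rfl
  rw [h, tracks_homMk, vanishes_iInf]
  simp only [vanishes_sup, Tracks]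

/-- Morphisms are determined by their action on sequences; one inclusion of graphs is enough. -/
theorem hom_ext_tracks {f g : A ⟶ B} (h : ∀ x y, Tracks f x y → Tracks g x y) : f = g := by
  rw [← homMk_rep f, ← homMk_rep g]
  refine homMk_eq fun x y => ⟨h x y, fun hg => ?_⟩
  obtain ⟨y', hy'⟩ := exists_tracks f (Tracks.left (f := g) hg)
  exact hy'.congr hy'.left ((h _ _ hy').unique hg)

/-- The morphism induced by a function compatible with the partial equivalence relations. -/
noncomputable def ofFun (φ : A.carrier → B.carrier)
    (hφ : ∀ x x', A.SeqRel x x' → B.SeqRel (fun n => φ (x n)) (fun n => φ (x' n))) : A ⟶ B :=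
  homMk (fun a b => A.rel a a ⊔ B.rel (φ a) b) <| by
    refine IsFunctional.of_seq ?_ ?_ ?_ ?_ <;> simp only [vanishes_sup]
    · rintro x y ⟨h, h'⟩
      exact ⟨h, SeqRel.right (A := B) h'⟩
    · rintro x x' y y' ⟨h, h'⟩ hx hy
      exact ⟨SeqRel.right (A := A) hx, (hφ _ _ (SeqRel.symm hx)).trans (SeqRel.trans h' hy)⟩
    · rintro x y y' ⟨_, h⟩ ⟨_, h'⟩
      exact SeqRel.trans (A := B) (SeqRel.symm h) h'
    · exact fun x hx => ⟨fun n => φ (x n), hx, hφ _ _ hx⟩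

theorem tracks_ofFun (φ : A.carrier → B.carrier)
    (hφ : ∀ x x', A.SeqRel x x' → B.SeqRel (fun n => φ (x n)) (fun n => φ (x' n)))
    (x : ℕ → A.carrier) (y : ℕ → B.carrier) :
    Tracks (ofFun φ hφ) x y ↔ A.Adm x ∧ B.SeqRel (fun n => φ (x n)) y := by
  rw [ofFun, tracks_homMk]
  exact vanishes_sup

/-- The relation of `seqObj`. -/
noncomputable def diagRel (m n : ℕ) : I := if m = n then invSucc m else 1

theorem diagRel_symm (m n : ℕ) : diagRel n m ≤ diagRel m n := by
  by_cases h : m = n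
  · rw [h]
  · simp [diagRel, h, unitInterval.le_one']

theorem diagRel_trans (m n p : ℕ) : diagRel m p ≤ diagRel m n ⊔ diagRel n p := by
  by_cases h : m = n
  · rw [h]
    exact le_sup_right
  · simp [diagRel, h, unitInterval.le_one']

/-- The generic admissible sequence: natural numbers, `n` being in the domain of the relation to
the degree `1 / (n + 1)` and distinct numbers being unrelated. -/
noncomputable def seqObj : PERU.{u} where
  carrier := ULift.{u} ℕ
  rel m n := diagRel m.down n.down
  symm := entails_iff_seq.mpr fun _ hp => hp.mono fun _ => diagRel_symm _ _
  trans := entails_iff_seq.mpr fun _ hp => hp.mono fun _ => diagRel_trans _ _ _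

/-- The natural number underlying an element of `seqObj`. -/
def idx (k : seqObj.{u}.carrier) : ℕ := ULift.down k

/-- The admissible sequences of `seqObj` are the sequences of numbers tending to infinity. -/
theorem seqObj_adm {k : ℕ → seqObj.{u}.carrier} (h : seqObj.Adm k) :
    Filter.Tendsto (fun n => idx (k n)) Filter.atTop Filter.atTop :=
  tendsto_of_vanishes_invSucc (Vanishes.mono h fun _ => (if_pos rfl).ge)

/-- Related sequences of `seqObj` agree from some point on, as distinct numbers are unrelated. -/
theorem seqObj_eventually_eq {k l : ℕ → seqObj.{u}.carrier} (h : seqObj.SeqRel k l) :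
    ∃ N, ∀ n, N ≤ n → idx (k n) = idx (l n) := by
  obtain ⟨N, hN⟩ := h (1 / 2) (by norm_num)
  refine ⟨N, fun n hn => by_contra fun hne => ?_⟩
  have h1 : (diagRel (idx (k n)) (idx (l n)) : ℝ) ≤ 1 / 2 := hN n hn
  rw [diagRel, if_neg hne] at h1
  norm_num at h1

/-- The tautological admissible sequence of `seqObj`. -/
def univSeq (n : ℕ) : seqObj.{u}.carrier := ULift.up n

theorem adm_univSeq : seqObj.{u}.Adm univSeq :=
  vanishes_invSucc.mono fun _ => (if_pos rfl).le

/-- The morphism out of `seqObj` classifying an admissible sequence. -/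
noncomputable def seqPt (a : ℕ → A.carrier) (ha : A.Adm a) : seqObj.{u} ⟶ A :=
  ofFun (fun n => a (idx n)) fun k l hkl ε hε => by
    obtain ⟨N, hN⟩ := seqObj_eventually_eq hkl
    obtain ⟨M, hM⟩ := Vanishes.comp ha (seqObj_adm hkl.left) ε hε
    refine ⟨max N M, fun n hn => ?_⟩
    change (A.rel (a (idx (k n))) (a (idx (l n))) : ℝ) ≤ ε
    rw [← hN n (le_of_max_le_left hn)]
    exact hM n (le_of_max_le_right hn)

theorem tracks_seqPt {a : ℕ → A.carrier} (ha : A.Adm a) (k : ℕ → seqObj.{u}.carrier)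
    (b : ℕ → A.carrier) :
    Tracks (seqPt a ha) k b ↔ seqObj.Adm k ∧ A.SeqRel (fun n => a (idx (k n))) b :=
  tracks_ofFun _ _ _ _

theorem tracks_seqPt_univSeq {a : ℕ → A.carrier} (ha : A.Adm a) :
    Tracks (seqPt a ha) univSeq a :=
  (tracks_seqPt ha _ _).mpr ⟨adm_univSeq, ha⟩

/-- A morphism acts on sequences as composition with it acts on morphisms from `seqObj`. -/
theorem seqPt_comp {f : A ⟶ B} {a : ℕ → A.carrier} {b : ℕ → B.carrier} (h : Tracks f a b) :
    seqPt a h.left ≫ f = seqPt b h.right := by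
  symm
  refine hom_ext_tracks fun k c hc => ?_
  rw [tracks_seqPt] at hc
  rw [tracks_comp]
  have h1 : Tracks f (fun n => a (idx (k n))) (fun n => b (idx (k n))) :=
    Vanishes.comp h (seqObj_adm hc.1)
  exact ⟨_, (tracks_seqPt _ _ _).mpr ⟨hc.1, h1.left⟩, h1.congr h1.left hc.2⟩

theorem seqPt_eq_iff {a b : ℕ → A.carrier} (ha : A.Adm a) (hb : A.Adm b) :
    seqPt a ha = seqPt b hb ↔ A.SeqRel a b := by
  constructor
  · intro h
    have h1 := tracks_seqPt_univSeq hb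
    rw [← h, tracks_seqPt] at h1
    exact h1.2
  · intro h
    refine hom_ext_tracks fun k c hc => ?_
    rw [tracks_seqPt] at hc ⊢
    exact ⟨hc.1, (SeqRel.symm (Vanishes.comp h (seqObj_adm hc.1) : A.SeqRel _ _)).trans hc.2⟩

/-! ### Monomorphisms, isomorphisms and strict relations -/

theorem mono_of_tracks {m : A ⟶ B}
    (h : ∀ a a' b, Tracks m a b → Tracks m a' b → A.SeqRel a a') : Mono m where
  right_cancellation {Z} f g hfg := hom_ext_tracks fun z a ha => by
    obtain ⟨b, hb⟩ := exists_tracks m ha.right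
    have : Tracks (g ≫ m) z b := hfg ▸ (tracks_comp f m z b).mpr ⟨a, ha, hb⟩
    obtain ⟨a', ha', hb'⟩ := (tracks_comp g m z b).mp this
    exact ha'.congr ha'.left (h _ _ _ hb' hb)

/-- Monomorphisms are injective on sequences: test against morphisms from `seqObj`. -/
theorem seqRel_of_mono (m : A ⟶ B) [Mono m] {a a' : ℕ → A.carrier} {b : ℕ → B.carrier}
    (h : Tracks m a b) (h' : Tracks m a' b) : A.SeqRel a a' := by
  rw [← seqPt_eq_iff h.left h'.left, ← cancel_mono m, seqPt_comp h, seqPt_comp h']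

theorem isIso_of_tracks {m : A ⟶ B}
    (inj : ∀ a a' b, Tracks m a b → Tracks m a' b → A.SeqRel a a')
    (surj : ∀ b, B.Adm b → ∃ a, Tracks m a b) : IsIso m := by
  have hF : IsFunctional B A fun b a => rep m a b :=
    IsFunctional.of_seq (fun x y (h : Tracks m y x) => ⟨h.right, h.left⟩)
      (fun x x' y y' (h : Tracks m y x) hx hy => h.congr hy hx)
      (fun x y y' h h' => inj y y' x h h') surj
  have ht : ∀ b a, Tracks (homMk _ hF : B ⟶ A) b a ↔ Tracks m a b := tracks_homMk hF
  refine ⟨homMk _ hF, hom_ext_tracks fun a a' h => ?_, hom_ext_tracks fun b b' h => ?_⟩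
  · obtain ⟨b, hb, hb'⟩ := (tracks_comp _ _ _ _).mp h
    exact (tracks_id _ _).mpr (inj _ _ _ hb ((ht _ _).mp hb'))
  · obtain ⟨a, ha, ha'⟩ := (tracks_comp _ _ _ _).mp h
    exact (tracks_id _ _).mpr (((ht _ _).mp ha).unique ha')

theorem IsStrictRel.adm {φ : A.carrier → I} (hφ : A.IsStrictRel φ) {x : ℕ → A.carrier}
    (hx : Vanishes fun n => φ (x n)) : A.Adm x :=
  hφ.strict.seq x hx

theorem IsStrictRel.congr {φ : A.carrier → I} (hφ : A.IsStrictRel φ) {x x' : ℕ → A.carrier}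
    (hx : Vanishes fun n => φ (x n)) (h : A.SeqRel x x') : Vanishes fun n => φ (x' n) :=
  hφ.relational.seq (fun n => (x n, x' n)) (vanishes_sup.mpr ⟨hx, h⟩)

theorem seqRel_restrict {φ : A.carrier → I} (hφ : A.IsStrictRel φ) (x x' : ℕ → A.carrier) :
    (A.restrict φ hφ).SeqRel x x' ↔ Vanishes (fun n => φ (x n)) ∧ A.SeqRel x x' :=
  vanishes_sup

theorem adm_restrict {φ : A.carrier → I} (hφ : A.IsStrictRel φ) (x : ℕ → A.carrier) :
    (A.restrict φ hφ).Adm x ↔ Vanishes (fun n => φ (x n)) :=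
  (seqRel_restrict hφ x x).trans ⟨fun h => h.1, fun h => ⟨h, hφ.adm h⟩⟩

theorem tracks_restrictIncl {φ : A.carrier → I} (hφ : A.IsStrictRel φ) (x x' : ℕ → A.carrier) :
    Tracks (A.restrictIncl φ hφ) x x' ↔ Vanishes (fun n => φ (x n)) ∧ A.SeqRel x x' :=
  (tracks_homMk _ _ _).trans vanishes_sup

instance mono_restrictIncl {φ : A.carrier → I} (hφ : A.IsStrictRel φ) :
    Mono (A.restrictIncl φ hφ) :=
  mono_of_tracks fun a a' b h h' => by
    have h := (tracks_restrictIncl hφ _ _).mp h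
    have h' := (tracks_restrictIncl hφ _ _).mp h'
    exact (seqRel_restrict hφ _ _).mpr ⟨h.1, h.2.trans h'.2.symm⟩

/-- A morphism factors through the subobject given by a strict relation if and only if its values
satisfy that relation. -/
theorem exists_comp_restrictIncl_iff {φ : A.carrier → I} (hφ : A.IsStrictRel φ) (f : B ⟶ A) :
    (∃ g, g ≫ A.restrictIncl φ hφ = f) ↔
      ∀ b a, Tracks f b a → Vanishes fun n => φ (a n) := by
  constructor
  · rintro ⟨g, rfl⟩ b a h
    obtain ⟨a', -, h'⟩ := (tracks_comp _ _ _ _).mp h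
    have h' := (tracks_restrictIncl hφ _ _).mp h'
    exact hφ.congr h'.1 h'.2
  · intro h
    have hF : IsFunctional B (A.restrict φ hφ) (rep (B := A) f) :=
      IsFunctional.of_seq
        (fun x y (hxy : Tracks f x y) => ⟨hxy.left, (adm_restrict hφ y).mpr (h _ _ hxy)⟩)
        (fun x x' y y' (hxy : Tracks f x y) hx hy => hxy.congr hx ((seqRel_restrict hφ _ _).mp hy).2)
        (fun x y y' (hxy : Tracks f x y) hxy' =>
          (seqRel_restrict hφ _ _).mpr ⟨h _ _ hxy, hxy.unique hxy'⟩)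
        (fun x hx => exists_tracks f hx)
    refine ⟨homMk _ hF, hom_ext_tracks fun b a hba => ?_⟩
    obtain ⟨a', h1, h2⟩ := (tracks_comp _ _ _ _).mp hba
    have h1 : Tracks f b a' := (tracks_homMk hF _ _).mp h1
    exact Tracks.congr (f := f) h1 (Tracks.left (f := f) h1)
      ((tracks_restrictIncl hφ _ _).mp h2).2

/-! ### Coverings -/

/-- A finite family is jointly covering if every admissible sequence of the target has a
subsequence coming from one of its members. -/
def Covers {ι : Type} {Y : ι → PERU.{u}} (f : ∀ i, Y i ⟶ X) : Prop :=
  ∀ x : ℕ → X.carrier, X.Adm x → ∃ (i : ι) (s : ℕ → ℕ), StrictMono s ∧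
    ∃ y : ℕ → (Y i).carrier, Tracks (f i) y fun n => x (s n)

/-- The union of the images of a family of morphisms, as a strict relation. -/
noncomputable def imageRel {ι : Type} {Y : ι → PERU.{u}} (f : ∀ i, Y i ⟶ X) (x : X.carrier) : I :=
  ⨅ i, ⨅ y, rep (f i) y x

theorem vanishes_image_iff {f : Y ⟶ X} {x : ℕ → X.carrier} :
    Vanishes (fun n => ⨅ y, rep f y (x n)) ↔ ∃ y, Tracks f y x :=
  vanishes_iInf

theorem vanishes_imageRel {ι : Type} {Y : ι → PERU.{u}} {f : ∀ i, Y i ⟶ X} {i : ι}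
    {y : ℕ → (Y i).carrier} {x : ℕ → X.carrier} (h : Tracks (f i) y x) :
    Vanishes fun n => imageRel f (x n) :=
  vanishes_iInf_of_vanishes i (vanishes_image_iff.mpr ⟨y, h⟩)

theorem exists_tracks_of_imageRel {ι : Type} [Finite ι] {Y : ι → PERU.{u}} {f : ∀ i, Y i ⟶ X}
    {x : ℕ → X.carrier} (h : Vanishes fun n => imageRel f (x n)) :
    ∃ (i : ι) (s : ℕ → ℕ), StrictMono s ∧
      ∃ y : ℕ → (Y i).carrier, Tracks (f i) y fun n => x (s n) := by
  obtain ⟨i, s, hs, hi⟩ := exists_vanishes_of_iInf h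
  exact ⟨i, s, hs, vanishes_image_iff.mp hi⟩

theorem isStrictRel_imageRel {ι : Type} [Finite ι] {Y : ι → PERU.{u}} (f : ∀ i, Y i ⟶ X) :
    X.IsStrictRel (imageRel f) where
  strict := entails_iff_seq.mpr fun x hx => vanishes_of_iInf hx fun i s hs h => by
    obtain ⟨y, hy⟩ := vanishes_image_iff.mp h
    exact hy.right
  relational := entails_iff_seq.mpr fun p hp => by
    obtain ⟨h1, h2⟩ := vanishes_sup.mp hp
    refine vanishes_of_iInf h1 fun i s hs h => ?_
    obtain ⟨y, hy⟩ := vanishes_image_iff.mp h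
    exact vanishes_imageRel (hy.congr hy.left (Vanishes.subseq h2 hs))

/-- The lattice-theoretic formulation of joint coverings, through the image, amounts to the
one in terms of sequences. -/
theorem covers_iff {ι : Type} [Finite ι] {Y : ι → PERU.{u}} (f : ∀ i, Y i ⟶ X) :
    Covers f ↔ ∀ A : Subobject X, (∀ i, A.Factors (f i)) → A = ⊤ := by
  constructor
  · intro h A hA
    have : IsIso A.arrow := by
      refine isIso_of_tracks (fun a a' b => seqRel_of_mono A.arrow) fun x hx => ?_
      rw [← vanishes_image_iff]
      refine vanishes_of_subseq fun s hs => ?_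
      obtain ⟨i, t, ht, y, hy⟩ := h _ (hx.subseq hs)
      refine ⟨t, ht, vanishes_image_iff.mpr ?_⟩
      rw [← A.factorThru_arrow _ (hA i), tracks_comp] at hy
      obtain ⟨a, -, ha⟩ := hy
      exact ⟨a, ha⟩
    exact Subobject.eq_top_of_isIso_arrow A
  · intro h x hx
    have h1 := h (Subobject.mk (X.restrictIncl _ (isStrictRel_imageRel f))) fun i => by
      rw [Subobject.mk_factors_iff]
      exact (exists_comp_restrictIncl_iff _ _).mpr fun y x hyx => vanishes_imageRel hyx
    have := (Subobject.isIso_iff_mk_eq_top _).mpr h1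
    have h2 : Tracks (inv (X.restrictIncl _ (isStrictRel_imageRel f)) ≫
        X.restrictIncl _ (isStrictRel_imageRel f)) x x := by
      rw [IsIso.inv_hom_id, tracks_id]
      exact hx
    obtain ⟨z, -, hz⟩ := (tracks_comp _ _ _ _).mp h2
    have hz := (tracks_restrictIncl _ _ _).mp hz
    exact exists_tracks_of_imageRel ((isStrictRel_imageRel f).congr hz.1 hz.2)

/-- A weak pullback of `h` and `f`: pairs `(a, y)` such that `h(a)` and `f(y)` exist and agree. -/
noncomputable def weakPullback (h : A ⟶ X) (f : Y ⟶ X) : PERU.{u} where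
  carrier := A.carrier × Y.carrier
  rel p q := (A.rel p.1 q.1 ⊔ Y.rel p.2 q.2) ⊔ ⨅ x, rep h p.1 x ⊔ rep f p.2 x
  symm := entails_iff_seq.mpr fun p hp => by
    simp only [vanishes_sup, vanishes_iInf] at hp ⊢
    obtain ⟨⟨h1, h2⟩, x, h3, h4⟩ := hp
    exact ⟨⟨A.symm_seq h1, Y.symm_seq h2⟩, x,
      Tracks.congr (f := h) h3 h1 (Tracks.right (f := h) h3),
      Tracks.congr (f := f) h4 h2 (Tracks.right (f := f) h4)⟩
  trans := entails_iff_seq.mpr fun p hp => by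
    simp only [vanishes_sup, vanishes_iInf] at hp ⊢
    obtain ⟨⟨⟨h1, h2⟩, h3⟩, ⟨h4, h5⟩, -⟩ := hp
    exact ⟨⟨A.trans_seq h1 h4, Y.trans_seq h2 h5⟩, h3⟩

theorem seqRel_weakPullback (h : A ⟶ X) (f : Y ⟶ X)
    (p q : ℕ → A.carrier × Y.carrier) :
    (weakPullback h f).SeqRel p q ↔ (A.SeqRel (fun n => (p n).1) (fun n => (q n).1) ∧
      Y.SeqRel (fun n => (p n).2) (fun n => (q n).2)) ∧
      ∃ x, Tracks h (fun n => (p n).1) x ∧ Tracks f (fun n => (p n).2) x := by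
  refine vanishes_sup.trans (and_congr vanishes_sup ?_)
  rw [vanishes_iInf]
  simp only [vanishes_sup]
  rfl

/-- The projection `(a, y) ↦ a` of the weak pullback. -/
noncomputable def weakPullbackFst (h : A ⟶ X) (f : Y ⟶ X) : weakPullback h f ⟶ A :=
  ofFun (A := weakPullback h f) Prod.fst fun _ _ hx => ((seqRel_weakPullback h f _ _).mp hx).1.1

/-- The projection `(a, y) ↦ y` of the weak pullback. -/
noncomputable def weakPullbackSnd (h : A ⟶ X) (f : Y ⟶ X) : weakPullback h f ⟶ Y :=
  ofFun (A := weakPullback h f) Prod.snd fun _ _ hx => ((seqRel_weakPullback h f _ _).mp hx).1.2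

theorem weakPullback_condition (h : A ⟶ X) (f : Y ⟶ X) :
    weakPullbackFst h f ≫ h = weakPullbackSnd h f ≫ f := by
  refine hom_ext_tracks fun p x hp => ?_
  obtain ⟨a, ha, hx⟩ := (tracks_comp _ _ _ _).mp hp
  obtain ⟨hp, ha⟩ := (tracks_ofFun _ _ _ _).mp ha
  obtain ⟨⟨h1, h2⟩, x', h3, h4⟩ := (seqRel_weakPullback h f _ _).mp hp
  exact (tracks_comp _ _ _ _).mpr ⟨_, (tracks_ofFun _ _ _ _).mpr ⟨hp, h2⟩,
    h4.congr h2 (h3.unique (hx.congr ha.symm hx.right))⟩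

theorem tracks_weakPullbackFst {h : A ⟶ X} {f : Y ⟶ X} {a : ℕ → A.carrier} {y : ℕ → Y.carrier}
    {x : ℕ → X.carrier} (ha : Tracks h a x) (hy : Tracks f y x) :
    Tracks (weakPullbackFst h f) (fun n => (a n, y n)) a :=
  (tracks_ofFun _ _ _ _).mpr
    ⟨(seqRel_weakPullback h f _ _).mpr ⟨⟨ha.left, hy.left⟩, x, ha, hy⟩, ha.left⟩

/-! ### The coherent topology -/

/-- A sieve is covering if it contains a finite jointly covering family. -/
def IsCovering (S : Sieve X) : Prop :=
  ∃ (ι : Type) (_ : Finite ι) (Y : ι → PERU.{u}) (f : ∀ i, Y i ⟶ X), (∀ i, S (f i)) ∧ Covers f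

theorem isCovering_iff (S : Sieve X) : IsCovering S ↔ IsCoherentCovering S := by
  constructor
  · rintro ⟨ι, _, Y, f, hS, hf⟩
    obtain ⟨n, ⟨e⟩⟩ := Finite.exists_equiv_fin ι
    refine ⟨n, fun i => Y (e.symm i), fun i => f (e.symm i), fun i => hS _, ?_⟩
    intro A hA
    refine (covers_iff f).mp hf A fun i => ?_
    obtain ⟨j, rfl⟩ := e.symm.surjective i
    exact hA j
  · rintro ⟨n, Y, f, hS, hf⟩
    exact ⟨Fin n, inferInstance, Y, f, hS, (covers_iff f).mpr hf⟩

/-- The coherent topology on partial equivalence relations. -/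
def coherentTop : GrothendieckTopology PERU.{u} where
  sieves X := {S | IsCovering S}
  top_mem' X := ⟨Unit, inferInstance, fun _ => X, fun _ => 𝟙 X, fun _ => trivial,
    fun x hx => ⟨(), fun n => n, strictMono_id, x, (tracks_id _ _).mpr hx⟩⟩
  pullback_stable' X A S h := by
    rintro ⟨ι, hι, Y, f, hS, hf⟩
    refine ⟨ι, hι, fun i => weakPullback h (f i), fun i => weakPullbackFst h (f i),
      fun i => ?_, fun a ha => ?_⟩
    · change S _
      rw [weakPullback_condition]
      exact S.downward_closed (hS i) _
    · obtain ⟨x, hx⟩ := exists_tracks h ha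
      obtain ⟨i, s, hs, y, hy⟩ := hf x hx.right
      exact ⟨i, s, hs, _, tracks_weakPullbackFst (hx.subseq hs) hy⟩
  transitive' X S hS R hR := by
    obtain ⟨ι, hι, Y, f, hS, hf⟩ := hS
    choose κ hκ Z g hRg hg using fun i => hR (hS i)
    refine ⟨Σ i, κ i, inferInstance, fun p => Z p.1 p.2, fun p => g p.1 p.2 ≫ f p.1,
      fun p => hRg p.1 p.2, fun x hx => ?_⟩
    obtain ⟨i, s, hs, y, hy⟩ := hf x hx
    obtain ⟨j, t, ht, z, hz⟩ := hg i y hy.left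
    exact ⟨⟨i, j⟩, fun n => s (t n), hs.comp ht, z,
      (tracks_comp _ _ _ _).mpr ⟨_, hz, hy.subseq ht⟩⟩

theorem mem_coherentTop (S : Sieve X) : S ∈ coherentTop X ↔ IsCoherentCovering S :=
  isCovering_iff S

theorem mem_coherentTop_of_covers {ι : Type} [Finite ι] {Y : ι → PERU.{u}} {f : ∀ i, Y i ⟶ X}
    (hf : Covers f) (S : Sieve X) (hS : ∀ i, S (f i)) : S ∈ coherentTop X :=
  ⟨ι, inferInstance, Y, f, hS, hf⟩

theorem exists_covers_of_mem {S : Sieve X} (h : S ∈ coherentTop X) :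
    ∃ (ι : Type) (_ : Finite ι) (Y : ι → PERU.{u}) (f : ∀ i, Y i ⟶ X),
      (∀ i, S (f i)) ∧ Covers f := h

/-- Glueing along a finite covering family: the relation
`H(x, z) = ∃ i, ∃ y, F_i(y, x) ∧ G_i(y, z)` is functional as soon as the `G_i` agree on sequences
with the same image in `X`. -/
theorem exists_glue {Z : PERU.{u}} {ι : Type} [Finite ι] {Y : ι → PERU.{u}} {f : ∀ i, Y i ⟶ X}
    (hf : Covers f) (g : ∀ i, Y i ⟶ Z)
    (hg : ∀ i j y y' x z z', Tracks (f i) y x → Tracks (f j) y' x → Tracks (g i) y z →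
      Tracks (g j) y' z' → Z.SeqRel z z') :
    ∃ h : X ⟶ Z, ∀ x z,
      (∀ s : ℕ → ℕ, StrictMono s → ∃ t : ℕ → ℕ, StrictMono t ∧ ∃ i y,
        Tracks (f i) y (fun n => x (s (t n))) ∧ Tracks (g i) y (fun n => z (s (t n)))) →
      Tracks h x z := by
  let K : ι → X.carrier → Z.carrier → I := fun i x z => ⨅ y, rep (f i) y x ⊔ rep (g i) y z
  have hK : ∀ i x z, Vanishes (fun n => K i (x n) (z n)) ↔
      ∃ y, Tracks (f i) y x ∧ Tracks (g i) y z := fun i x z => by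
    rw [vanishes_iInf]
    simp only [vanishes_sup]
    rfl
  have hH : IsFunctional X Z fun x z => ⨅ i, K i x z := by
    refine IsFunctional.of_seq ?_ ?_ ?_ ?_
    · intro x z h
      rw [← vanishes_sup]
      refine vanishes_of_iInf h fun i s hs h => ?_
      obtain ⟨y, h1, h2⟩ := (hK i _ _).mp h
      exact vanishes_sup.mpr ⟨h1.right, h2.right⟩
    · intro x x' z z' h hx hz
      refine vanishes_of_iInf h fun i s hs h => ?_
      obtain ⟨y, h1, h2⟩ := (hK i _ _).mp h
      exact vanishes_iInf_of_vanishes i ((hK i _ _).mpr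
        ⟨y, h1.congr h1.left (Vanishes.subseq hx hs), h2.congr h2.left (Vanishes.subseq hz hs)⟩)
    · intro x z z' h h'
      refine vanishes_of_iInf h fun i s hs h => ?_
      refine vanishes_of_iInf (h'.subseq hs) fun j t ht h' => ?_
      obtain ⟨y, h1, h2⟩ := (hK i _ _).mp (h.subseq ht)
      obtain ⟨y', h1', h2'⟩ := (hK j _ _).mp h'
      exact hg i j y y' _ _ _ h1 h1' h2 h2'
    · intro x hx
      refine (vanishes_iInf (a := fun n z => ⨅ i, K i (x n) z)).mp ?_
      refine vanishes_of_subseq fun s hs => ?_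
      obtain ⟨i, t, ht, y, hy⟩ := hf _ (Adm.subseq hx hs)
      obtain ⟨z, hz⟩ := exists_tracks (g i) hy.left
      exact ⟨t, ht, vanishes_iInf.mpr
        ⟨z, vanishes_iInf_of_vanishes i ((hK i _ _).mpr ⟨y, hy, hz⟩)⟩⟩
  refine ⟨homMk _ hH, fun x z h => (tracks_homMk hH x z).mpr ?_⟩
  refine vanishes_of_subseq fun s hs => ?_
  obtain ⟨t, ht, i, y, h1, h2⟩ := h s hs
  exact ⟨t, ht, vanishes_iInf_of_vanishes i ((hK i _ _).mpr ⟨y, h1, h2⟩)⟩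

/-- A finite covering family is jointly epimorphic. -/
theorem hom_ext_of_covers {Z : PERU.{u}} {ι : Type} {Y : ι → PERU.{u}} {f : ∀ i, Y i ⟶ X}
    (hf : Covers f) {g h : X ⟶ Z} (hgh : ∀ i, f i ≫ g = f i ≫ h) : g = h := by
  refine hom_ext_tracks fun x z hxz => vanishes_of_subseq fun s hs => ?_
  obtain ⟨i, t, ht, y, hy⟩ := hf _ (hxz.left.subseq hs)
  refine ⟨t, ht, ?_⟩
  have h1 : Tracks (f i ≫ g) y fun n => z (s (t n)) :=
    (tracks_comp _ _ _ _).mpr ⟨_, hy, hxz.subseq (hs.comp ht)⟩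
  rw [hgh, tracks_comp] at h1
  obtain ⟨x', h1, h2⟩ := h1
  exact h2.congr (h1.unique hy) h2.right

/-- A matching family on a covering sieve agrees on sequences with the same image, so the members
indexed by a finite covering family glue. -/
instance subcanonical_coherentTop : coherentTop.{u}.Subcanonical := by
  refine GrothendieckTopology.Subcanonical.of_isSheaf_yoneda_obj _ fun Z X S hS ξ hξ => ?_
  obtain ⟨ι, hι, Y, f, hSf, hf⟩ := exists_covers_of_mem hS
  -- compatibility of the family, tested on sequences
  have key : ∀ {A B : PERU.{u}} (p : A ⟶ X) (q : B ⟶ X) (hp : S p) (hq : S q)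
      (a : ℕ → A.carrier) (b : ℕ → B.carrier) (x : ℕ → X.carrier) (z z' : ℕ → Z.carrier),
      Tracks p a x → Tracks q b x → Tracks (A := A) (B := Z) (ξ p hp) a z →
      Tracks (A := B) (B := Z) (ξ q hq) b z' → Z.SeqRel z z' := by
    intro A B p q hp hq a b x z z' h1 h2 h3 h4
    have h5 := hξ (seqPt a h1.left) (seqPt b h2.left) hp hq
      ((seqPt_comp h1).trans (seqPt_comp h2).symm)
    have h6 : seqPt a h1.left ≫ (ξ p hp : A ⟶ Z) = seqPt b h2.left ≫ (ξ q hq : B ⟶ Z) := h5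
    rw [seqPt_comp h3, seqPt_comp h4, seqPt_eq_iff] at h6
    exact h6
  obtain ⟨h, hh⟩ := exists_glue hf (Z := Z) (fun i => ξ (f i) (hSf i))
    fun i j y y' x z z' => key _ _ _ _ _ _ _ _ _
  have am : ∀ {A : PERU.{u}} (p : A ⟶ X) (hp : S p), p ≫ h = ξ p hp := by
    intro A p hp
    symm
    refine hom_ext_tracks (A := A) (B := Z) fun a z haz => ?_
    obtain ⟨x, hx⟩ := exists_tracks p haz.left
    refine (tracks_comp _ _ _ _).mpr ⟨x, hx, hh x z fun s hs => ?_⟩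
    obtain ⟨i, t, ht, y, hy⟩ := hf _ (hx.right.subseq hs)
    obtain ⟨z', hz'⟩ := exists_tracks (A := Y i) (B := Z) (ξ (f i) (hSf i)) hy.left
    exact ⟨t, ht, i, y, hy, hz'.congr hz'.left
      (key _ _ _ _ _ _ _ _ _ hy (hx.subseq (hs.comp ht)) hz' (haz.subseq (hs.comp ht)))⟩
  exact ⟨h, fun A p hp => am p hp, fun h' hh' => hom_ext_of_covers hf fun i =>
    (hh' (f i) (hSf i)).trans (am _ _).symm⟩

end PERU

/-! ### Continuous model theory: predicates and vanishing sequences -/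

/-- The minimum of two sequences vanishes if and only if every subsequence has a further
subsequence along which one of the two vanishes. -/
theorem vanishes_inf_iff {a b : ℕ → I} :
    Vanishes (fun n => a n ⊓ b n) ↔ ∀ s : ℕ → ℕ, StrictMono s → ∃ t : ℕ → ℕ, StrictMono t ∧
      (Vanishes (fun n => a (s (t n))) ∨ Vanishes fun n => b (s (t n))) := by
  have key : ∀ n, a n ⊓ b n = ⨅ i : Bool, bif i then a n else b n := fun n => by
    rw [iInf_bool_eq]; rfl
  constructor
  · intro h s hs
    have h' := h.subseq hs
    simp only [key] at h'
    obtain ⟨i, t, ht, hi⟩ := exists_vanishes_of_iInf h'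
    refine ⟨t, ht, ?_⟩
    cases i
    · exact Or.inr hi
    · exact Or.inl hi
  · intro h
    refine vanishes_of_subseq fun s hs => ?_
    obtain ⟨t, ht, h | h⟩ := h s hs
    · exact ⟨t, ht, h.mono fun n => inf_le_left⟩
    · exact ⟨t, ht, h.mono fun n => inf_le_right⟩

theorem iInf_le_iInf_add {ι : Type u} {a b : ι → I} {ε : ℝ} (hε : 0 ≤ ε)
    (h : ∀ i, (a i : ℝ) ≤ b i + ε) : ((⨅ i, a i : I) : ℝ) ≤ (⨅ i, b i : I) + ε := by
  by_contra hc
  push Not at hc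
  have hmem : ((⨅ i, a i : I) : ℝ) - ε ∈ unitInterval :=
    ⟨by linarith [(⨅ i, b i : I).2.1], by linarith [(⨅ i, a i : I).2.2]⟩
  have hlt : (⨅ i, b i) < (⟨_, hmem⟩ : I) := by
    rw [← Subtype.coe_lt_coe]
    change _ < ((⨅ i, a i : I) : ℝ) - ε
    linarith
  obtain ⟨i, hi⟩ := iInf_lt_iff.mp hlt
  have h1 : (b i : ℝ) < ((⨅ i, a i : I) : ℝ) - ε := hi
  have h2 : ((⨅ i, a i : I) : ℝ) ≤ a i := iInf_le a i
  linarith [h i]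

theorem iSup_le_iSup_add {ι : Type u} {a b : ι → I} {ε : ℝ} (hε : 0 ≤ ε)
    (h : ∀ i, (a i : ℝ) ≤ b i + ε) : ((⨆ i, a i : I) : ℝ) ≤ (⨆ i, b i : I) + ε := by
  by_contra hc
  push Not at hc
  have hmem : ((⨆ i, b i : I) : ℝ) + ε ∈ unitInterval :=
    ⟨by linarith [(⨆ i, b i : I).2.1], by linarith [(⨆ i, a i : I).2.2]⟩
  have hlt : (⟨_, hmem⟩ : I) < (⨆ i, a i) := hc
  obtain ⟨i, hi⟩ := lt_iSup_iff.mp hlt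
  have h1 : ((⨆ i, b i : I) : ℝ) + ε < a i := hi
  have h2 : (b i : ℝ) ≤ (⨆ i, b i : I) := le_iSup b i
  linarith [h i]

theorem uniformContinuous_iff_le {X : Type u} [PseudoMetricSpace X] {φ : X → I} :
    UniformContinuous φ ↔ ∀ ε : ℝ, 0 < ε → ∃ δ : ℝ, 0 < δ ∧ ∀ x x', dist x x' < δ →
      (φ x : ℝ) ≤ φ x' + ε := by
  rw [Metric.uniformContinuous_iff]
  constructor
  · intro h ε hε
    obtain ⟨δ, hδ, H⟩ := h ε hε
    refine ⟨δ, hδ, fun x x' hx => ?_⟩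
    have := H hx
    rw [Subtype.dist_eq, Real.dist_eq] at this
    linarith [(abs_lt.mp this).2]
  · intro h ε hε
    obtain ⟨δ, hδ, H⟩ := h (ε / 2) (by positivity)
    refine ⟨δ, hδ, fun {x x'} hx => ?_⟩
    rw [Subtype.dist_eq, Real.dist_eq, abs_lt]
    have h1 := H x x' hx
    have h2 := H x' x (by rwa [dist_comm])
    constructor <;> linarith

namespace CMTPred

variable {X Y Z : CMet.{u}}

theorem le_iff {α β : CMTPred X} : α ≤ β ↔ ∀ x : ℕ → X.carrier,
    Vanishes (fun n => α.1 (x n)) → Vanishes fun n => β.1 (x n) :=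
  entails_iff_seq

/-- Predicates are invariant under moving points by a distance tending to `0`. -/
theorem vanishes_congr (α : CMTPred X) {x x' : ℕ → X.carrier}
    (h : Vanishes fun n => α.1 (x n)) (hx : Vanishes fun n => X.idist (x n) (x' n)) :
    Vanishes fun n => α.1 (x' n) :=
  (isStrictRel_of_uniformContinuous X α).congr h hx

/-- The true predicate, with constant value `0`. -/
def top : CMTPred X := ⟨fun _ => 0, uniformContinuous_const⟩

/-- The false predicate, with constant value `1`. -/
def bot : CMTPred X := ⟨fun _ => 1, uniformContinuous_const⟩

/-- Conjunction is the maximum. -/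
noncomputable def meet (α β : CMTPred X) : CMTPred X := ⟨fun x => α.1 x ⊔ β.1 x, by
  rw [uniformContinuous_iff_le]
  intro ε hε
  obtain ⟨δ, hδ, H⟩ := uniformContinuous_iff_le.mp α.2 ε hε
  obtain ⟨δ', hδ', H'⟩ := uniformContinuous_iff_le.mp β.2 ε hε
  refine ⟨min δ δ', lt_min hδ hδ', fun x x' hx => ?_⟩
  have h1 := H x x' (hx.trans_le (min_le_left _ _))
  have h2 := H' x x' (hx.trans_le (min_le_right _ _))
  have h3 : (α.1 x' : ℝ) ≤ (α.1 x' ⊔ β.1 x' : I) := le_sup_left (a := α.1 x')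
  have h4 : (β.1 x' : ℝ) ≤ (α.1 x' ⊔ β.1 x' : I) := le_sup_right (a := α.1 x')
  rcases le_total (α.1 x) (β.1 x) with h | h
  · rw [sup_eq_right.mpr h]; linarith
  · rw [sup_eq_left.mpr h]; linarith⟩

/-- Disjunction is the minimum. -/
noncomputable def join (α β : CMTPred X) : CMTPred X := ⟨fun x => α.1 x ⊓ β.1 x, by
  rw [uniformContinuous_iff_le]
  intro ε hε
  obtain ⟨δ, hδ, H⟩ := uniformContinuous_iff_le.mp α.2 ε hε
  obtain ⟨δ', hδ', H'⟩ := uniformContinuous_iff_le.mp β.2 ε hε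
  refine ⟨min δ δ', lt_min hδ hδ', fun x x' hx => ?_⟩
  have h1 := H x x' (hx.trans_le (min_le_left _ _))
  have h2 := H' x x' (hx.trans_le (min_le_right _ _))
  have h3 : ((α.1 x ⊓ β.1 x : I) : ℝ) ≤ α.1 x := inf_le_left (a := α.1 x)
  have h4 : ((α.1 x ⊓ β.1 x : I) : ℝ) ≤ β.1 x := inf_le_right (a := α.1 x)
  rcases le_total (α.1 x') (β.1 x') with h | h
  · rw [inf_eq_left.mpr h]; linarith
  · rw [inf_eq_right.mpr h]; linarith⟩

theorem not_vanishes_one : ¬ Vanishes fun _ => 1 := fun h => by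
  obtain ⟨N, hN⟩ := h (1 / 2) (by norm_num)
  have : ((1 : I) : ℝ) ≤ 1 / 2 := hN N le_rfl
  norm_num at this

theorem isTop_iff (α : CMTPred X) : IsTop α ↔ ∀ x : ℕ → X.carrier,
    Vanishes fun n => α.1 (x n) :=
  ⟨fun h x => le_iff.mp (h top) x fun _ hε => ⟨0, fun _ _ => hε.le⟩,
    fun h _ => le_iff.mpr fun x _ => h x⟩

theorem isBot_iff (α : CMTPred X) : IsBot α ↔ ∀ x : ℕ → X.carrier,
    ¬ Vanishes fun n => α.1 (x n) :=
  ⟨fun h x hx => not_vanishes_one (le_iff.mp (h bot) x hx),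
    fun h _ => le_iff.mpr fun x hx => (h x hx).elim⟩

theorem isGLB_iff (α β γ : CMTPred X) : IsGLB {α, β} γ ↔ ∀ x : ℕ → X.carrier,
    (Vanishes fun n => γ.1 (x n)) ↔
      (Vanishes fun n => α.1 (x n)) ∧ Vanishes fun n => β.1 (x n) := by
  constructor
  · intro h x
    constructor
    · intro hx
      exact ⟨le_iff.mp (h.1 (by simp)) x hx, le_iff.mp (h.1 (by simp)) x hx⟩
    · intro hx
      have : meet α β ≤ γ := h.2 (by
        rintro δ (rfl | rfl)
        · exact le_iff.mpr fun x hx => (vanishes_sup.mp hx).1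
        · exact le_iff.mpr fun x hx => (vanishes_sup.mp hx).2)
      exact le_iff.mp this x (vanishes_sup.mpr hx)
  · intro h
    refine ⟨?_, fun δ hδ => le_iff.mpr fun x hx => (h x).mpr
      ⟨le_iff.mp (hδ (by simp)) x hx, le_iff.mp (hδ (by simp)) x hx⟩⟩
    rintro δ (rfl | rfl)
    · exact le_iff.mpr fun x hx => ((h x).mp hx).1
    · exact le_iff.mpr fun x hx => ((h x).mp hx).2

theorem isLUB_iff (α β γ : CMTPred X) : IsLUB {α, β} γ ↔ ∀ x : ℕ → X.carrier,
    (Vanishes fun n => γ.1 (x n)) ↔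
      ∀ s : ℕ → ℕ, StrictMono s → ∃ t : ℕ → ℕ, StrictMono t ∧
        ((Vanishes fun n => α.1 (x (s (t n)))) ∨ Vanishes fun n => β.1 (x (s (t n)))) := by
  have le_of : ∀ δ : CMTPred X, α ≤ δ → β ≤ δ → ∀ x : ℕ → X.carrier,
      (∀ s : ℕ → ℕ, StrictMono s → ∃ t : ℕ → ℕ, StrictMono t ∧
        ((Vanishes fun n => α.1 (x (s (t n)))) ∨ Vanishes fun n => β.1 (x (s (t n))))) →
      Vanishes fun n => δ.1 (x n) := fun δ h1 h2 x hx =>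
    vanishes_of_subseq fun s hs => by
      obtain ⟨t, ht, h | h⟩ := hx s hs
      · exact ⟨t, ht, le_iff.mp h1 _ h⟩
      · exact ⟨t, ht, le_iff.mp h2 _ h⟩
  constructor
  · intro h x
    constructor
    · intro hx
      have : γ ≤ join α β := h.2 (by
        rintro δ (rfl | rfl)
        · exact le_iff.mpr fun x hx => hx.mono fun n => inf_le_left
        · exact le_iff.mpr fun x hx => hx.mono fun n => inf_le_right)
      exact vanishes_inf_iff.mp (le_iff.mp this x hx)
    · exact le_of γ (h.1 (by simp)) (h.1 (by simp)) x
  · intro h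
    refine ⟨?_, fun δ hδ => le_iff.mpr fun x hx =>
      le_of δ (hδ (by simp)) (hδ (by simp)) x ((h x).mp hx)⟩
    rintro δ (rfl | rfl)
    · exact le_iff.mpr fun x hx => (h x).mpr fun s hs => ⟨id, strictMono_id, Or.inl (hx.subseq hs)⟩
    · exact le_iff.mpr fun x hx => (h x).mpr fun s hs => ⟨id, strictMono_id, Or.inr (hx.subseq hs)⟩

end CMTPred

/-! ### Products of complete metric spaces -/

namespace CMet

variable {X Y Z : CMet.{u}}

theorem comp_apply {f : X ⟶ Y} {g : Y ⟶ Z} (x : X.carrier) :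
    Hom.toFun (f ≫ g) x = Hom.toFun g (Hom.toFun f x) := rfl

theorem apply_congr {f g : X ⟶ Y} (h : f = g) (x : X.carrier) : Hom.toFun f x = Hom.toFun g x := by
  rw [h]

/-- A product cone identifies its apex with the product of the underlying sets, by a uniformly
continuous map in either direction. -/
theorem exists_pairing {p : Z ⟶ X} {q : Z ⟶ Y} (h : IsLimit (BinaryFan.mk p q)) :
    ∃ s : CMet.prod X Y ⟶ Z, (∀ x y, Hom.toFun p (Hom.toFun s (x, y)) = x) ∧
      (∀ x y, Hom.toFun q (Hom.toFun s (x, y)) = y) ∧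
      ∀ z, Hom.toFun s (Hom.toFun p z, Hom.toFun q z) = z := by
  let s : CMet.prod X Y ⟶ Z := h.lift (BinaryFan.mk (fst X Y) (snd X Y))
  have h1 : s ≫ p = fst X Y := h.fac _ ⟨WalkingPair.left⟩
  have h2 : s ≫ q = snd X Y := h.fac _ ⟨WalkingPair.right⟩
  let r : Z ⟶ CMet.prod X Y := (prodIsLimit X Y).lift (BinaryFan.mk p q)
  have h3 : r ≫ s = 𝟙 Z := by
    refine BinaryFan.IsLimit.hom_ext h ?_ ?_
    · change (r ≫ s) ≫ p = 𝟙 Z ≫ p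
      rw [Category.assoc, h1, Category.id_comp]
      rfl
    · change (r ≫ s) ≫ q = 𝟙 Z ≫ q
      rw [Category.assoc, h2, Category.id_comp]
      rfl
  exact ⟨s, fun x y => apply_congr h1 (x, y), fun x y => apply_congr h2 (x, y),
    fun z => apply_congr h3 z⟩

theorem vanishes_map_hom (f : X ⟶ Y) {x x' : ℕ → X.carrier}
    (h : Vanishes fun n => X.idist (x n) (x' n)) :
    Vanishes fun n => Y.idist (Hom.toFun f (x n)) (Hom.toFun f (x' n)) :=
  vanishes_map (Hom.uniformContinuous f) h

theorem vanishes_idist_prod_iff {p : Z ⟶ X} {q : Z ⟶ Y} (h : IsLimit (BinaryFan.mk p q))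
    (z z' : ℕ → Z.carrier) :
    (Vanishes fun n => Z.idist (z n) (z' n)) ↔
      (Vanishes fun n => X.idist (Hom.toFun p (z n)) (Hom.toFun p (z' n))) ∧
      Vanishes fun n => Y.idist (Hom.toFun q (z n)) (Hom.toFun q (z' n)) := by
  refine ⟨fun hz => ⟨vanishes_map_hom p hz, vanishes_map_hom q hz⟩, fun hz => ?_⟩
  obtain ⟨s, -, -, hs⟩ := exists_pairing h
  have h1 : Vanishes fun n => (CMet.prod X Y).idist (Hom.toFun p (z n), Hom.toFun q (z n))
      (Hom.toFun p (z' n), Hom.toFun q (z' n)) := by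
    refine Vanishes.mono (vanishes_sup.mpr hz) fun n => ?_
    rw [← Subtype.coe_le_coe]
    refine (Prod.dist_eq (α := X.carrier) (β := Y.carrier)).le.trans (max_le ?_ ?_)
    · exact le_sup_left (a := X.idist _ _)
    · exact le_sup_right (b := Y.idist _ _)
  have h2 := vanishes_map_hom s h1
  simp only [hs] at h2
  exact h2

end CMet

namespace CMTPred

open CMet

variable {X Y Z : CMet.{u}}

/-! ### Quantifiers and equality -/

/-- Along the projection from `X × Y`, the infimum over `Y` of a uniformly continuous function is
uniformly continuous and vanishes along the images of the sequences along which `α` does. -/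
theorem exists_existsPred {p : Z ⟶ X} (hp : IsProjection p) (α : CMTPred Z) :
    ∃ e : CMTPred X, ∀ x : ℕ → X.carrier, (Vanishes fun n => e.1 (x n)) ↔
      ∃ z : ℕ → Z.carrier, (∀ n, Hom.toFun p (z n) = x n) ∧ Vanishes fun n => α.1 (z n) := by
  obtain ⟨Y, q, ⟨h⟩⟩ := hp
  obtain ⟨s, hs1, -, hs2⟩ := exists_pairing h
  refine ⟨⟨fun x => ⨅ y, α.1 (Hom.toFun s (x, y)), ?_⟩, fun x => ?_⟩
  · rw [uniformContinuous_iff_le]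
    intro ε hε
    obtain ⟨δ, hδ, H⟩ := uniformContinuous_iff_le.mp (α.2.comp (Hom.uniformContinuous s)) ε hε
    refine ⟨δ, hδ, fun x x' hx => iInf_le_iInf_add hε.le fun y => H (x, y) (x', y) ?_⟩
    refine lt_of_eq_of_lt (Prod.dist_eq (α := X.carrier) (β := Y.carrier)) ?_
    exact max_lt hx (lt_of_eq_of_lt (dist_self y) hδ)
  · refine vanishes_iInf.trans ⟨?_, ?_⟩
    · rintro ⟨y, hy⟩
      exact ⟨fun n => Hom.toFun s (x n, y n), fun n => hs1 _ _, hy⟩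
    · rintro ⟨z, hz, h⟩
      refine ⟨fun n => Hom.toFun q (z n), ?_⟩
      simpa only [← hz, hs2] using h

/-- Along the projection from `X × Y`, the supremum over `Y` of a uniformly continuous function is
uniformly continuous and vanishes along `x` if and only if `α` does along all sequences over `x`. -/
theorem exists_forallPred {p : Z ⟶ X} (hp : IsProjection p) (α : CMTPred Z) :
    ∃ a : CMTPred X, ∀ x : ℕ → X.carrier, (Vanishes fun n => a.1 (x n)) ↔
      ∀ z : ℕ → Z.carrier, (∀ n, Hom.toFun p (z n) = x n) → Vanishes fun n => α.1 (z n) := by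
  obtain ⟨Y, q, ⟨h⟩⟩ := hp
  obtain ⟨s, hs1, -, hs2⟩ := exists_pairing h
  refine ⟨⟨fun x => ⨆ y, α.1 (Hom.toFun s (x, y)), ?_⟩, fun x => ⟨fun hx z hz => ?_, fun hx => ?_⟩⟩
  · rw [uniformContinuous_iff_le]
    intro ε hε
    obtain ⟨δ, hδ, H⟩ := uniformContinuous_iff_le.mp (α.2.comp (Hom.uniformContinuous s)) ε hε
    refine ⟨δ, hδ, fun x x' hx => iSup_le_iSup_add hε.le fun y => H (x, y) (x', y) ?_⟩
    refine lt_of_eq_of_lt (Prod.dist_eq (α := X.carrier) (β := Y.carrier)) ?_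
    exact max_lt hx (lt_of_eq_of_lt (dist_self y) hδ)
  · refine hx.mono fun n => ?_
    have := le_iSup (fun y => α.1 (Hom.toFun s (x n, y))) (Hom.toFun q (z n))
    simpa only [← hz, hs2] using this
  · -- otherwise the supremum exceeds some `ε` infinitely often, and so do values of `α`
    intro ε hε
    by_contra hc
    push Not at hc
    have key : ∀ n, (ε < ((⨆ y, α.1 (Hom.toFun s (x n, y)) : I) : ℝ)) →
        ∃ y, ε < (α.1 (Hom.toFun s (x n, y)) : ℝ) := by
      intro n hn
      have hmem : ε ∈ unitInterval := ⟨hε.le, hn.le.trans (⨆ y, α.1 (Hom.toFun s (x n, y)) : I).2.2⟩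
      have hlt : (⟨ε, hmem⟩ : I) < ⨆ y, α.1 (Hom.toFun s (x n, y)) := hn
      obtain ⟨y, hy⟩ := lt_iSup_iff.mp hlt
      exact ⟨y, hy⟩
    obtain ⟨n₀, -, hn₀⟩ := hc 0
    obtain ⟨y₀, -⟩ := key n₀ hn₀
    have hch : ∀ n, ∃ y, (ε < ((⨆ y, α.1 (Hom.toFun s (x n, y)) : I) : ℝ)) →
        ε < (α.1 (Hom.toFun s (x n, y)) : ℝ) := by
      intro n
      by_cases hn : ε < ((⨆ y, α.1 (Hom.toFun s (x n, y)) : I) : ℝ)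
      · obtain ⟨y, hy⟩ := key n hn
        exact ⟨y, fun _ => hy⟩
      · exact ⟨y₀, fun h => (hn h).elim⟩
    choose y hy using hch
    obtain ⟨N, hN⟩ := hx (fun n => Hom.toFun s (x n, y n)) (fun n => hs1 _ _) ε hε
    obtain ⟨n, hn, hn'⟩ := hc N
    exact absurd (hN n hn) (not_le.mpr (hy n hn'))

theorem isExists_iff {p : Z ⟶ X} (hp : IsProjection p) (α : CMTPred Z) (e : CMTPred X) :
    CMT.IsExists p α e ↔ ∀ x : ℕ → X.carrier, (Vanishes fun n => e.1 (x n)) ↔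
      ∃ z : ℕ → Z.carrier, (∀ n, Hom.toFun p (z n) = x n) ∧ Vanishes fun n => α.1 (z n) := by
  have of : ∀ e : CMTPred X, (∀ x : ℕ → X.carrier, (Vanishes fun n => e.1 (x n)) ↔
      ∃ z : ℕ → Z.carrier, (∀ n, Hom.toFun p (z n) = x n) ∧ Vanishes fun n => α.1 (z n)) →
      CMT.IsExists p α e := by
    intro e he (β : CMTPred X)
    refine le_iff.trans (Iff.trans ⟨fun h z hz => ?_, fun h x hx => ?_⟩ le_iff.symm)
    · exact h _ ((he _).mpr ⟨z, fun _ => rfl, hz⟩)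
    · obtain ⟨z, hz, hα⟩ := (he x).mp hx
      have : Vanishes fun n => β.1 (Hom.toFun p (z n)) := h z hα
      simpa only [hz] using this
  refine ⟨fun h x => ?_, of e⟩
  obtain ⟨e', he'⟩ := exists_existsPred hp α
  rw [← he']
  exact ⟨le_iff.mp ((h e').mpr ((of e' he' e').mp (le_refl (α := CMTPred X) e'))) x,
    le_iff.mp ((of e' he' e).mpr ((h e).mp (le_refl (α := CMTPred X) e))) x⟩

theorem isForall_iff {p : Z ⟶ X} (hp : IsProjection p) (α : CMTPred Z) (a : CMTPred X) :
    CMT.IsForall p α a ↔ ∀ x : ℕ → X.carrier, (Vanishes fun n => a.1 (x n)) ↔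
      ∀ z : ℕ → Z.carrier, (∀ n, Hom.toFun p (z n) = x n) → Vanishes fun n => α.1 (z n) := by
  have of : ∀ a : CMTPred X, (∀ x : ℕ → X.carrier, (Vanishes fun n => a.1 (x n)) ↔
      ∀ z : ℕ → Z.carrier, (∀ n, Hom.toFun p (z n) = x n) → Vanishes fun n => α.1 (z n)) →
      CMT.IsForall p α a := by
    intro a ha (β : CMTPred X)
    refine le_iff.trans (Iff.trans ⟨fun h z hz => ?_, fun h x hx => ?_⟩ le_iff.symm)
    · exact (ha _).mp (h _ hz) z fun _ => rfl
    · refine (ha x).mpr fun z hz => h z ?_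
      change Vanishes fun n => β.1 (Hom.toFun p (z n))
      simpa only [hz] using hx
  refine ⟨fun h x => ?_, of a⟩
  obtain ⟨a', ha'⟩ := exists_forallPred hp α
  rw [← ha']
  exact ⟨le_iff.mp ((of a' ha' a).mpr ((h a).mp (le_refl (α := CMTPred X) a))) x,
    le_iff.mp ((h a').mpr ((of a' ha' a').mp (le_refl (α := CMTPred X) a'))) x⟩

theorem uniformContinuous_idist (X : CMet.{u}) :
    UniformContinuous fun p : X.carrier × X.carrier => X.idist p.1 p.2 :=
  UniformContinuous.subtype_mk uniformContinuous_dist _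

/-- The metric as a predicate on the categorical product. -/
noncomputable def eqPred (X : CMet.{u}) : CMTPred (X ⨯ X) :=
  ⟨fun z => X.idist (Hom.toFun (prod.fst : X ⨯ X ⟶ X) z) (Hom.toFun (prod.snd : X ⨯ X ⟶ X) z),
    (uniformContinuous_idist X).comp ((Hom.uniformContinuous _).prodMk (Hom.uniformContinuous _))⟩

theorem isEq_eqPred (X : CMet.{u}) : CMT.IsEq X (eqPred X) := by
  intro (A : CMTPred (X ⨯ X))
  have hfst : ∀ x, Hom.toFun (prod.fst : X ⨯ X ⟶ X) (Hom.toFun (diag X) x) = x := fun x =>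
    apply_congr (prod.lift_fst (𝟙 X) (𝟙 X)) x
  have hsnd : ∀ x, Hom.toFun (prod.snd : X ⨯ X ⟶ X) (Hom.toFun (diag X) x) = x := fun x =>
    apply_congr (prod.lift_snd (𝟙 X) (𝟙 X)) x
  refine (isTop_iff _).trans (Iff.trans ⟨fun h z hz => ?_, fun h x => ?_⟩ le_iff.symm)
  · refine vanishes_congr A (h fun n => Hom.toFun (prod.fst : X ⨯ X ⟶ X) (z n)) ?_
    rw [vanishes_idist_prod_iff (prodIsProd X X)]
    simp only [hfst, hsnd]
    exact ⟨X.vanishes_self _, hz⟩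
  · refine h (fun n => Hom.toFun (diag X) (x n)) ?_
    change Vanishes fun n => X.idist _ _
    simp only [hfst, hsnd]
    exact X.vanishes_self x

theorem isEq_iff {X : CMet.{u}} (e : CMTPred (X ⨯ X)) :
    CMT.IsEq X e ↔ ∀ z : ℕ → (X ⨯ X).carrier, (Vanishes fun n => e.1 (z n)) ↔
      Vanishes fun n => X.idist (Hom.toFun (prod.fst : X ⨯ X ⟶ X) (z n))
        (Hom.toFun (prod.snd : X ⨯ X ⟶ X) (z n)) := by
  have h0 := isEq_eqPred X
  constructor
  · intro h z
    exact ⟨le_iff.mp ((h (eqPred X)).mp ((h0 (eqPred X)).mpr (le_refl (α := CMTPred (X ⨯ X)) _))) z,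
      le_iff.mp ((h0 e).mp ((h e).mpr (le_refl (α := CMTPred (X ⨯ X)) _))) z⟩
  · intro h A
    refine (h0 A).trans (le_iff.trans (Iff.trans ?_ le_iff.symm))
    exact forall_congr' fun z => imp_congr_left (h z).symm

/-- A compatible pair of points lifts to the apex of a pullback square. -/
theorem exists_lift_of_isPullback {A B D E : CMet.{u}} {π : A ⟶ B} {f : A ⟶ D}
    {g : B ⟶ E} {π' : D ⟶ E} (sq : IsPullback π f g π') (b : B.carrier) (d : D.carrier)
    (h : Hom.toFun g b = Hom.toFun π' d) :
    ∃ a, Hom.toFun π a = b ∧ Hom.toFun f a = d := by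
  let pb : CMet.point ⟶ B := Hom.mk (X := CMet.point) (fun _ => b) uniformContinuous_const
  let pd : CMet.point ⟶ D := Hom.mk (X := CMet.point) (fun _ => d) uniformContinuous_const
  have hw : pb ≫ g = pd ≫ π' := hom_ext fun _ => h
  exact ⟨Hom.toFun (sq.lift pb pd hw) PUnit.unit, apply_congr (sq.lift_fst pb pd hw) _,
    apply_congr (sq.lift_snd pb pd hw) _⟩

theorem isDistPrelattice (X : CMet.{u}) : IsDistPrelattice (CMTPred X) where
  exists_top := ⟨top, (isTop_iff _).mpr fun x ε hε => ⟨0, fun _ _ => hε.le⟩⟩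
  exists_bot := ⟨bot, (isBot_iff _).mpr fun x hx => not_vanishes_one hx⟩
  exists_meet α β := ⟨meet α β, (isGLB_iff _ _ _).mpr fun _ => vanishes_sup⟩
  exists_join α β := ⟨join α β, (isLUB_iff _ _ _).mpr fun _ => vanishes_inf_iff⟩
  distrib a b c bc a_bc ab ac h1 h2 h3 h4 := by
    rw [isLUB_iff] at h1 ⊢
    rw [isGLB_iff] at h2 h3 h4
    intro x
    rw [h2, h1]
    constructor
    · rintro ⟨ha, h⟩ s hs
      obtain ⟨t, ht, h | h⟩ := h s hs
      · exact ⟨t, ht, Or.inl ((h3 _).mpr ⟨ha.subseq (hs.comp ht), h⟩)⟩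
      · exact ⟨t, ht, Or.inr ((h4 _).mpr ⟨ha.subseq (hs.comp ht), h⟩)⟩
    · intro h
      refine ⟨vanishes_of_subseq fun s hs => ?_, fun s hs => ?_⟩
      · obtain ⟨t, ht, h | h⟩ := h s hs
        · exact ⟨t, ht, ((h3 _).mp h).1⟩
        · exact ⟨t, ht, ((h4 _).mp h).1⟩
      · obtain ⟨t, ht, h | h⟩ := h s hs
        · exact ⟨t, ht, Or.inl ((h3 _).mp h).2⟩
        · exact ⟨t, ht, Or.inr ((h4 _).mp h).2⟩

theorem isPrelatticeHom_map (f : X ⟶ Y) : IsPrelatticeHom (CMT.map f) where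
  monotone := (CMT.map f).monotone
  map_top t h := (isTop_iff _).mpr fun x => (isTop_iff t).mp h fun n => Hom.toFun f (x n)
  map_bot t h := (isBot_iff _).mpr fun x => (isBot_iff t).mp h fun n => Hom.toFun f (x n)
  map_meet a b m h := (isGLB_iff _ _ _).mpr fun x =>
    (isGLB_iff a b m).mp h fun n => Hom.toFun f (x n)
  map_join a b m h := (isLUB_iff _ _ _).mpr fun x =>
    (isLUB_iff a b m).mp h fun n => Hom.toFun f (x n)

end CMTPred

open CMet CMTPred

theorem CMT_isUniversallyCoherent : CMT.{u}.IsUniversallyCoherent where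
  distPrelattice X := CMTPred.isDistPrelattice X
  prelatticeHom f := isPrelatticeHom_map f
  exists_eq X := ⟨_, isEq_eqPred X⟩
  eq_prod A B eA eB eAB hA hB hAB := by
    have hA := (CMTPred.isEq_iff eA).mp hA
    have hB := (CMTPred.isEq_iff eB).mp hB
    have hAB := (CMTPred.isEq_iff eAB).mp hAB
    refine (CMTPred.isGLB_iff _ _ _).mpr fun z => ?_
    refine (hAB z).trans ((vanishes_idist_prod_iff (prodIsProd A B) _ _).trans ?_)
    refine (and_congr ((hA _).trans ?_) ((hB _).trans ?_)).symm
    · have e1 := fun n => apply_congr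
        (prod.map_fst (prod.fst : A ⨯ B ⟶ A) (prod.fst : A ⨯ B ⟶ A)) (z n)
      have e2 := fun n => apply_congr
        (prod.map_snd (prod.fst : A ⨯ B ⟶ A) (prod.fst : A ⨯ B ⟶ A)) (z n)
      simp only [comp_apply] at e1 e2
      simp only [e1, e2]
    · have e1 := fun n => apply_congr
        (prod.map_fst (prod.snd : A ⨯ B ⟶ B) (prod.snd : A ⨯ B ⟶ B)) (z n)
      have e2 := fun n => apply_congr
        (prod.map_snd (prod.snd : A ⨯ B ⟶ B) (prod.snd : A ⨯ B ⟶ B)) (z n)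
      simp only [comp_apply] at e1 e2
      simp only [e1, e2]
  exists_exists π hπ α := by
    obtain ⟨e, he⟩ := exists_existsPred hπ α
    exact ⟨e, (isExists_iff hπ α e).mpr he⟩
  exists_forall π hπ α := by
    obtain ⟨e, he⟩ := exists_forallPred hπ α
    exact ⟨e, (isForall_iff hπ α e).mpr he⟩
  frobenius {Y X} π hπ α β e m k he hm hk := by
    have he := (CMTPred.isExists_iff hπ β e).mp he
    have hm := (CMTPred.isGLB_iff α e m).mp hm
    have hk := (CMTPred.isGLB_iff (CMT.map π α) β k).mp hk
    refine (CMTPred.isExists_iff hπ k m).mpr fun x => ?_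
    rw [hm, he]
    constructor
    · rintro ⟨h, z, hz, h'⟩
      refine ⟨z, hz, (hk z).mpr ⟨?_, h'⟩⟩
      change Vanishes fun n => α.1 (Hom.toFun π (z n))
      simpa only [hz] using h
    · rintro ⟨z, hz, h⟩
      obtain ⟨h1, h2⟩ := (hk z).mp h
      have h1 : Vanishes fun n => α.1 (Hom.toFun π (z n)) := h1
      simp only [hz] at h1
      exact ⟨h1, z, hz, h2⟩
  beckChevalley_exists π f g π' sq hπ hπ' α e he := by
    have he := (CMTPred.isExists_iff hπ' α e).mp he
    refine (CMTPred.isExists_iff hπ (CMT.map f α) (CMT.map g e)).mpr fun b => ?_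
    refine (he _).trans ⟨?_, ?_⟩
    · rintro ⟨d, hd, h⟩
      choose a ha ha' using fun n => exists_lift_of_isPullback sq (b n) (d n) (hd n).symm
      refine ⟨a, ha, ?_⟩
      change Vanishes fun n => α.1 (Hom.toFun f (a n))
      simpa only [ha'] using h
    · rintro ⟨a, ha, h⟩
      refine ⟨fun n => Hom.toFun f (a n), fun n => ?_, h⟩
      rw [← ha]
      exact (apply_congr sq.w (a n)).symm
  beckChevalley_forall π f g π' sq hπ hπ' α e he := by
    have he := (CMTPred.isForall_iff hπ' α e).mp he
    refine (CMTPred.isForall_iff hπ (CMT.map f α) (CMT.map g e)).mpr fun b => ?_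
    refine (he _).trans ⟨?_, ?_⟩
    · intro h a ha
      refine h (fun n => Hom.toFun f (a n)) fun n => ?_
      rw [← ha]
      exact (apply_congr sq.w (a n)).symm
    · intro h d hd
      choose a ha ha' using fun n => exists_lift_of_isPullback sq (b n) (d n) (hd n).symm
      have h1 : Vanishes fun n => α.1 (Hom.toFun f (a n)) := h a ha
      simpa only [ha'] using h1

open PERU CMet

/-! ### The functor from complete metric spaces to partial equivalence relations -/

section FunctorG

variable {X Y Z : CMet.{u}} {A B : PERU.{u}}

theorem adm_toPER (x : ℕ → X.carrier) : (G.obj X).Adm x :=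
  X.vanishes_self x

theorem tracks_G_map (f : X ⟶ Y) (x : ℕ → X.carrier) (y : ℕ → Y.carrier) :
    Tracks (G.map f) x y ↔ Vanishes fun n => Y.idist (Hom.toFun f (x n)) (y n) :=
  tracks_homMk (A := G.obj X) (B := G.obj Y) _ x y

theorem tracks_G_map_self (f : X ⟶ Y) (x : ℕ → X.carrier) :
    Tracks (G.map f) x fun n => Hom.toFun f (x n) :=
  (tracks_G_map f x _).mpr (Y.vanishes_self _)

/-- A constant sequence in `[0,1]` vanishes only if its value is `0`. -/
theorem eq_zero_of_vanishes_const {a : I} (h : Vanishes fun _ => a) : a = 0 := by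
  have h0 : (a : ℝ) ≤ 0 := le_of_forall_pos_le_add fun ε hε => by
    obtain ⟨N, hN⟩ := h ε hε
    simpa using hN N le_rfl
  exact Subtype.ext (le_antisymm h0 a.2.1)

theorem vanishes_zero {a : ℕ → I} (h : ∀ n, a n = 0) : Vanishes a := fun ε hε =>
  ⟨0, fun n _ => by rw [h n]; exact hε.le⟩

instance faithful_G : G.{u}.Faithful where
  map_injective {X Y} f g h := hom_ext fun x => by
    have h1 : Tracks (G.map f) (fun _ => x) fun _ => Hom.toFun g x := by
      rw [h]; exact tracks_G_map_self g _
    rw [tracks_G_map] at h1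
    have h2 := congrArg Subtype.val (eq_zero_of_vanishes_const h1)
    exact dist_eq_zero.mp h2

/-- Completeness provides, for every `x`, a point `y` with `F(x, y) = 0`. -/
theorem exists_rep_eq_zero (f : G.obj X ⟶ G.obj Y) (x : X.carrier) :
    ∃ y : Y.carrier, rep f x y = 0 := by
  obtain ⟨y, hy⟩ := exists_tracks f (adm_toPER fun _ => x)
  have hc : CauchySeq (α := Y.carrier) y := by
    refine Metric.cauchySeq_iff.mpr ?_
    intro ε hε
    obtain ⟨δ, hδ, H⟩ := (isFunctional_rep f).singleValued (ε / 2) (by positivity)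
    obtain ⟨N, hN⟩ := hy δ hδ
    refine ⟨N, fun m hm n hn => ?_⟩
    have h1 : dist (α := Y.carrier) (y m) (y n) ≤ ε / 2 := H (x, y m, y n) (by
      rcases le_total (rep f x (y m)) (rep f x (y n)) with h | h
      · exact (congrArg Subtype.val (sup_eq_right.mpr h)).le.trans (hN n hn)
      · exact (congrArg Subtype.val (sup_eq_left.mpr h)).le.trans (hN m hm))
    linarith
  obtain ⟨l, hl⟩ := cauchySeq_tendsto_of_complete hc
  have h : Tracks f (fun _ => x) fun _ => l := by
    refine hy.congr (adm_toPER _) ?_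
    intro ε hε
    obtain ⟨N, hN⟩ := Metric.tendsto_atTop.mp hl ε hε
    exact ⟨N, fun n hn => (hN n hn).le⟩
  exact ⟨l, eq_zero_of_vanishes_const h⟩

theorem uniformContinuous_of_vanishes {f : X.carrier → Y.carrier}
    (h : ∀ x x' : ℕ → X.carrier, (Vanishes fun n => X.idist (x n) (x' n)) →
      Vanishes fun n => Y.idist (f (x n)) (f (x' n))) : UniformContinuous f := by
  have h1 : Entails (fun p : X.carrier × X.carrier => X.idist p.1 p.2)
      (fun p => Y.idist (f p.1) (f p.2)) := entails_iff_seq.mpr fun p hp => h _ _ hp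
  rw [Metric.uniformContinuous_iff]
  intro ε hε
  obtain ⟨δ, hδ, H⟩ := h1 (ε / 2) (by positivity)
  refine ⟨δ, hδ, fun {x x'} hx => ?_⟩
  have : dist (f x) (f x') ≤ ε / 2 := H (x, x') (le_of_lt hx)
  linarith

/-- A morphism `F` from `G(X)` to `G(Y)` is the image of a map `φ` with `F(x, φ(x)) = 0`. -/
instance full_G : G.{u}.Full where
  map_surjective {X Y} f := by
    choose φ hφ using exists_rep_eq_zero f
    have ht : ∀ x : ℕ → X.carrier, Tracks f x fun n => φ (x n) := fun x =>
      vanishes_zero fun n => hφ _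
    refine ⟨Hom.mk φ (uniformContinuous_of_vanishes fun x x' hx => ?_), ?_⟩
    · exact ((ht x).congr hx (adm_toPER _)).unique (ht x')
    · refine hom_ext_tracks fun x y hxy => ?_
      exact (ht x).congr (adm_toPER _) ((tracks_G_map _ _ _).mp hxy)

/-- `G` sends the point to a terminal object. -/
noncomputable def isTerminalGPoint : IsTerminal (G.{u}.obj CMet.point) :=
  IsTerminal.ofUniqueHom
    (fun _ => ofFun (fun _ => PUnit.unit) fun _ _ _ => CMet.point.vanishes_self _)
    (fun _ _ => hom_ext_tracks fun _ _ hxy => (tracks_ofFun _ _ _ _).mpr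
      ⟨hxy.left, CMet.point.vanishes_self _⟩)

theorem seqRel_G_prod (p q : ℕ → (CMet.prod X Y).carrier) :
    (G.obj (CMet.prod X Y)).SeqRel p q ↔
      (G.obj X).SeqRel (fun n => (p n).1) (fun n => (q n).1) ∧
      (G.obj Y).SeqRel (fun n => (p n).2) (fun n => (q n).2) :=
  vanishes_idist_prod_iff (prodIsLimit X Y) p q

theorem isFunctional_pair (f : A ⟶ G.obj X) (g : A ⟶ G.obj Y) :
    IsFunctional A (G.obj (CMet.prod X Y)) fun a p => rep f a p.1 ⊔ rep g a p.2 := by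
  refine IsFunctional.of_seq ?_ ?_ ?_ ?_ <;> simp only [vanishes_sup]
  · rintro x y ⟨h, h'⟩
    exact ⟨Tracks.left (f := f) h, adm_toPER _⟩
  · rintro x x' y y' ⟨h, h'⟩ hx hy
    have hy := (seqRel_G_prod y y').mp hy
    exact ⟨Tracks.congr (f := f) h hx hy.1, Tracks.congr (f := g) h' hx hy.2⟩
  · rintro x y y' ⟨h1, h2⟩ ⟨h1', h2'⟩
    exact (seqRel_G_prod y y').mpr ⟨Tracks.unique (f := f) h1 h1', Tracks.unique (f := g) h2 h2'⟩
  · intro x hx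
    obtain ⟨y, hy⟩ := exists_tracks f hx
    obtain ⟨z, hz⟩ := exists_tracks g hx
    exact ⟨fun n => (y n, z n), hy, hz⟩

theorem tracks_pair (f : A ⟶ G.obj X) (g : A ⟶ G.obj Y) (a : ℕ → A.carrier)
    (p : ℕ → (CMet.prod X Y).carrier) :
    Tracks (homMk _ (isFunctional_pair f g) : A ⟶ G.obj (CMet.prod X Y)) a p ↔
      Tracks f a (fun n => (p n).1) ∧ Tracks g a (fun n => (p n).2) :=
  (tracks_homMk _ _ _).trans vanishes_sup

/-- `G` sends products with the maximum metric to products. -/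
noncomputable def isLimitGProd (X Y : CMet.{u}) :
    IsLimit (BinaryFan.mk (G.map (CMet.fst X Y)) (G.map (CMet.snd X Y))) :=
  BinaryFan.isLimitMk
    (fun s => homMk _ (isFunctional_pair s.fst s.snd))
    (fun s => by
      symm
      refine hom_ext_tracks fun a x hx => ?_
      obtain ⟨y, hy⟩ := exists_tracks s.snd hx.left
      exact (tracks_comp _ _ _ _).mpr ⟨fun n => (x n, y n), (tracks_pair _ _ _ _).mpr ⟨hx, hy⟩,
        tracks_G_map_self (CMet.fst X Y) _⟩)
    (fun s => by
      symm
      refine hom_ext_tracks fun a y hy => ?_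
      obtain ⟨x, hx⟩ := exists_tracks s.fst hy.left
      exact (tracks_comp _ _ _ _).mpr ⟨fun n => (x n, y n), (tracks_pair _ _ _ _).mpr ⟨hx, hy⟩,
        tracks_G_map_self (CMet.snd X Y) _⟩)
    (fun s m h₁ h₂ => hom_ext_tracks fun a p hp => (tracks_pair _ _ _ _).mpr (by
      rw [← h₁, ← h₂]
      exact ⟨(tracks_comp _ _ _ _).mpr ⟨p, hp, tracks_G_map_self (CMet.fst X Y) p⟩,
        (tracks_comp _ _ _ _).mpr ⟨p, hp, tracks_G_map_self (CMet.snd X Y) p⟩⟩))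

instance preservesFiniteProducts_G : PreservesFiniteProducts G.{u} := by
  have h1 : ∀ X Y : CMet.{u}, PreservesLimit (pair X Y) G := fun X Y =>
    preservesLimit_of_preserves_limit_cone (prodIsLimit X Y)
      ((isLimitMapConeBinaryFanEquiv G _ _).symm (isLimitGProd X Y))
  have h2 : PreservesLimit (Functor.empty.{0} CMet.{u}) G :=
    preservesLimit_of_preserves_limit_cone pointIsTerminal
      ((isLimitMapConeEmptyConeEquiv G _).symm isTerminalGPoint)
  have h3 : PreservesLimitsOfShape (Discrete WalkingPair) G :=
    ⟨fun {K} => preservesLimit_of_iso_diagram G (diagramIsoPair K).symm⟩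
  have h4 : PreservesLimitsOfShape (Discrete PEmpty.{1}) G :=
    preservesLimitsOfShape_pempty_of_preservesTerminal G
  exact .of_preserves_binary_and_terminal G

end FunctorG

/-! ### Predicates as subobjects of representable sheaves -/

section Embedding

open Opposite

variable {X Y : CMet.{u}}

/-- The category of sheaves for the coherent topology. -/
abbrev CohSheaf : Type (u + 2) := Sheaf coherentTop.{u} (Type (u + 1))

/-- The Yoneda embedding of partial equivalence relations into coherent sheaves. -/
noncomputable abbrev yon : PERU.{u} ⥤ CohSheaf.{u} :=
  GrothendieckTopology.uliftYoneda.{u + 1} coherentTop.{u}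

instance mono_yon_predIncl (X : CMet.{u}) (φ : CMTPred X) : Mono (yon.map (predIncl X φ)) :=
  haveI : Mono (predIncl X φ) := mono_restrictIncl _
  inferInstance

instance preservesFiniteProducts_G_yon : PreservesFiniteProducts (G.{u} ⋙ yon.{u}) :=
  haveI : PreservesFiniteProducts yon.{u} := ⟨fun _ => inferInstance⟩
  comp_preservesFiniteProducts _ _

/-- The subobject of `y(G(X))` given by a predicate. -/
noncomputable def predSub (X : CMet.{u}) (φ : CMTPred X) : Subobject ((G ⋙ yon).obj X) :=
  Subobject.mk (yon.map (predIncl X φ))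

/-- A section of `y(G(X))`, as a morphism. -/
def secHom {B : PERU.{u}} {U : PERU.{u}ᵒᵖ} (h : (yon.obj B).obj.obj U) : U.unop ⟶ B := h.down

/-- A section of `y(G(X))` over `U`, that is, a morphism `U ⟶ G(X)`, lies in the subobject of `φ`
if and only if its values satisfy `φ`. -/
theorem mem_secs_predSub (φ : CMTPred X) {U : PERU.{u}ᵒᵖ} (h : ((G ⋙ yon).obj X).obj.obj U) :
    h ∈ (secs (predSub X φ)).obj U ↔
      ∀ a x, Tracks (secHom (B := G.obj X) h) a x → Vanishes fun n => φ.1 (x n) := by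
  rw [predSub, secs_mk]
  refine Iff.trans ?_ (exists_comp_restrictIncl_iff
    (isStrictRel_of_uniformContinuous X φ) (secHom (B := G.obj X) h))
  constructor
  · rintro ⟨g, rfl⟩
    exact ⟨g.down, rfl⟩
  · rintro ⟨g, hg⟩
    exact ⟨⟨g⟩, ULift.ext _ _ hg⟩

theorem mem_sheafify_of_covers {F : PERU.{u}ᵒᵖ ⥤ Type (u + 1)} (T : Subfunctor F)
    {U : PERU.{u}ᵒᵖ} (h : F.obj U) {ι : Type} [Finite ι] {V : ι → PERU.{u}}
    {f : ∀ i, V i ⟶ U.unop} (hf : Covers f) (H : ∀ i, F.map (f i).op h ∈ T.obj (op (V i))) :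
    h ∈ (T.sheafify coherentTop).obj U :=
  mem_coherentTop_of_covers hf _ H

/-- The nontrivial direction evaluates sections at the generic sequence `seqObj`. -/
theorem predSub_le_iff (φ ψ : CMTPred X) : predSub X φ ≤ predSub X ψ ↔ φ ≤ ψ := by
  rw [← secs_le_secs, CMTPred.le_iff]
  constructor
  · intro h x hx
    have h1 : (⟨seqPt x (adm_toPER x)⟩ : ((G ⋙ yon).obj X).obj.obj (op seqObj)) ∈
        (secs (predSub X φ)).obj _ := by
      refine (mem_secs_predSub φ (U := op seqObj) ⟨seqPt x (adm_toPER x)⟩).mpr ?_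
      intro k b hk
      obtain ⟨hk, hb⟩ := (tracks_seqPt (adm_toPER x) k b).mp hk
      exact φ.vanishes_congr (Vanishes.comp hx (seqObj_adm hk)) hb
    exact (mem_secs_predSub ψ _).mp (h _ h1) _ _ (tracks_seqPt_univSeq (adm_toPER x))
  · intro h U g hg
    rw [mem_secs_predSub] at hg ⊢
    exact fun a x hx => h x (hg a x hx)

theorem secs_predSub_map (f : X ⟶ Y) (α : CMTPred Y) :
    secs (predSub X (CMT.map f α)) =
      (secs (predSub Y α)).preimage ((G ⋙ yon).map f).hom := by
  ext U h
  refine (mem_secs_predSub _ _).trans (Iff.trans ?_ (mem_secs_predSub (X := Y) α _).symm)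
  have hc : secHom (B := G.obj Y) (((G ⋙ yon).map f).hom.app U h) =
      secHom (B := G.obj X) h ≫ G.map f := rfl
  rw [hc]
  constructor
  · intro H a y hy
    obtain ⟨x, hx, hy⟩ := (tracks_comp _ _ _ _).mp hy
    exact α.vanishes_congr (H a x hx) ((tracks_G_map f _ _).mp hy)
  · intro H a x hx
    exact H a _ ((tracks_comp _ _ _ _).mpr ⟨x, hx, tracks_G_map_self f x⟩)

theorem isPrelatticeHom_predSub (X : CMet.{u}) : IsPrelatticeHom (predSub X) where
  monotone φ ψ h := (predSub_le_iff φ ψ).mpr h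
  map_top t h := by
    rw [isTop_iff_secs, eq_top_iff]
    intro U g _
    rw [mem_secs_predSub]
    exact fun a x _ => (CMTPred.isTop_iff t).mp h x
  map_bot b h := by
    rw [isBot_iff_secs]
    refine le_antisymm (fun U g hg => ?_)
      ((sheafify_mono bot_le).trans (sheafify_secs _).le)
    -- the domain of `g` has no admissible sequence, hence is covered by the empty family
    rw [mem_secs_predSub] at hg
    refine mem_sheafify_of_covers (ι := PEmpty) _ g (V := PEmpty.elim) (f := fun i => i.elim)
      (fun a ha => ?_) (fun i => i.elim)
    obtain ⟨x, hx⟩ := exists_tracks (secHom (B := G.obj X) g) ha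
    exact ((CMTPred.isBot_iff b).mp h x (hg a x hx)).elim
  map_meet a b m h := by
    rw [isGLB_iff_secs]
    rw [CMTPred.isGLB_iff] at h
    ext U g
    refine (mem_secs_predSub _ _).trans (Iff.trans ?_
      (and_congr (mem_secs_predSub a g) (mem_secs_predSub b g)).symm)
    exact ⟨fun H => ⟨fun c x hx => ((h x).mp (H c x hx)).1, fun c x hx => ((h x).mp (H c x hx)).2⟩,
      fun H c x hx => (h x).mpr ⟨H.1 c x hx, H.2 c x hx⟩⟩
  map_join a b j h := by
    rw [isLUB_iff_secs]
    refine le_antisymm (fun U g hg => ?_) ((sheafify_mono (sup_le ?_ ?_)).trans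
      (sheafify_secs _).le)
    · -- the parts of the domain of `g` on which `a`, respectively `b`, holds cover it
      rw [mem_secs_predSub] at hg
      let c : Bool → CMTPred X := fun i => bif i then a else b
      have hmem : ∀ i, ((G ⋙ yon).obj X).obj.map
          (weakPullbackFst (secHom (B := G.obj X) g) (predIncl X (c i))).op g ∈
            (secs (predSub X (c i))).obj _ := by
        intro i
        rw [mem_secs_predSub]
        refine (exists_comp_restrictIncl_iff (isStrictRel_of_uniformContinuous X (c i)) _).mp
          ⟨weakPullbackSnd _ _, ?_⟩
        exact (weakPullback_condition _ _).symm
      refine mem_sheafify_of_covers _ g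
        (f := fun i => weakPullbackFst (secHom (B := G.obj X) g) (predIncl X (c i)))
        (fun d hd => ?_) fun i => ?_
      · obtain ⟨x, hx⟩ := exists_tracks (secHom (B := G.obj X) g) hd
        obtain ⟨t, ht, h'⟩ := ((CMTPred.isLUB_iff a b j).mp h x).mp (hg d x hx) id strictMono_id
        have key : ∀ i, (Vanishes fun n => (c i).1 (x (t n))) → ∃ y,
            Tracks (weakPullbackFst (secHom (B := G.obj X) g) (predIncl X (c i))) y
              fun n => d (t n) := fun i hi =>
          ⟨_, tracks_weakPullbackFst (hx.subseq ht)
            ((tracks_restrictIncl (isStrictRel_of_uniformContinuous X (c i)) _ _).mpr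
              ⟨hi, adm_toPER _⟩)⟩
        rcases h' with h' | h'
        · exact ⟨true, t, ht, key true h'⟩
        · exact ⟨false, t, ht, key false h'⟩
      · cases i
        · exact Or.inr (hmem false)
        · exact Or.inl (hmem true)
    · exact secs_le_secs.mpr ((predSub_le_iff _ _).mpr (h.1 (by simp)))
    · exact secs_le_secs.mpr ((predSub_le_iff _ _).mpr (h.1 (by simp)))

theorem secs_predSub_exists {p : Y ⟶ X} (hp : IsProjection p) (α : CMTPred Y) (e : CMTPred X)
    (he : CMT.IsExists p α e) :
    secs (predSub X e) =
      ((secs (predSub Y α)).image ((G ⋙ yon).map p).hom).sheafify coherentTop := by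
  refine le_antisymm (fun U g hg => ?_) ?_
  · rw [mem_secs_predSub] at hg
    rw [CMTPred.isExists_iff hp] at he
    refine mem_sheafify_of_covers (ι := Unit) _ g
      (f := fun _ => weakPullbackFst (secHom (B := G.obj X) g) (predIncl Y α ≫ G.map p))
      (fun d hd => ?_) fun _ => ?_
    · obtain ⟨x, hx⟩ := exists_tracks (secHom (B := G.obj X) g) hd
      obtain ⟨z, hz, hα⟩ := (he x).mp (hg d x hx)
      refine ⟨(), id, strictMono_id, _, tracks_weakPullbackFst hx
        ((tracks_comp _ _ _ _).mpr ⟨z, (tracks_restrictIncl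
          (isStrictRel_of_uniformContinuous Y α) _ _).mpr ⟨hα, adm_toPER z⟩, ?_⟩)⟩
      rw [← funext hz]
      exact tracks_G_map_self p z
    · refine ⟨⟨weakPullbackSnd (secHom (B := G.obj X) g) (predIncl Y α ≫ G.map p) ≫
        predIncl Y α⟩, ?_, ULift.ext _ _ ?_⟩
      · exact (mem_secs_predSub α (U := op _) ⟨_⟩).mpr
          ((exists_comp_restrictIncl_iff (isStrictRel_of_uniformContinuous Y α) _).mp ⟨_, rfl⟩)
      · refine Eq.trans ?_ (weakPullback_condition _ _).symm
        exact Category.assoc (weakPullbackSnd (secHom (B := G.obj X) g) (predIncl Y α ≫ G.map p))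
          (predIncl Y α) (G.map p)
  · rw [← sheafify_secs (predSub X e)]
    refine sheafify_mono ?_
    rw [Subfunctor.image_le_iff, ← secs_predSub_map, secs_le_secs]
    exact (predSub_le_iff (X := Y) _ _).mpr ((he e).mp (le_refl (α := CMTPred X) e))

theorem secs_predSub_forall {p : Y ⟶ X} (hp : IsProjection p) (α : CMTPred Y) (e : CMTPred X)
    (he : CMT.IsForall p α e) :
    secs (predSub X e) =
      forallSubfunctor ((G ⋙ yon).map p) (secs (predSub Y α)) := by
  refine le_antisymm ?_ (fun U g hg => ?_)
  · rw [le_forallSubfunctor_iff, ← secs_predSub_map, secs_le_secs]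
    exact (predSub_le_iff (X := Y) _ _).mpr ((he e).mp (le_refl (α := CMTPred X) e))
  · -- it is enough to restrict `g` along morphisms from `seqObj`
    rw [mem_secs_predSub]
    intro a x hx
    refine ((CMTPred.isForall_iff hp α e).mp he x).mpr fun z hz => ?_
    have h1 := hg (op seqObj) (seqPt a hx.left).op ⟨seqPt z (adm_toPER z)⟩ (by
      have ht : Tracks (G.map p) z x := by
        rw [← funext hz]
        exact tracks_G_map_self p z
      exact ULift.ext _ _ ((seqPt_comp ht).trans (seqPt_comp hx).symm))
    exact (mem_secs_predSub α _).mp h1 _ _ (tracks_seqPt_univSeq (adm_toPER z))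

theorem secs_predSub_eq (e : CMTPred (X ⨯ X)) (he : CMT.IsEq X e)
    (e' : Subobject ((G ⋙ yon).obj X ⨯ (G ⋙ yon).obj X))
    (he' : ∀ U z, z ∈ (secs e').obj U ↔
      (prod.fst : (G ⋙ yon).obj X ⨯ (G ⋙ yon).obj X ⟶ _).hom.app U z =
        (prod.snd : (G ⋙ yon).obj X ⨯ (G ⋙ yon).obj X ⟶ _).hom.app U z) :
    secs (predSub (X ⨯ X) e) = (secs e').preimage (prodComparison (G ⋙ yon) X X).hom := by
  ext U g
  have e1 := congrArg (fun k => k.hom.app U g) (prodComparison_fst (G ⋙ yon) (A := X) (B := X))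
  have e2 := congrArg (fun k => k.hom.app U g) (prodComparison_snd (G ⋙ yon) (A := X) (B := X))
  have he := (CMTPred.isEq_iff e).mp he
  refine (mem_secs_predSub _ _).trans (Iff.trans ?_ (he' U _).symm)
  have h1 : ((prod.fst : (G ⋙ yon).obj X ⨯ (G ⋙ yon).obj X ⟶ _).hom.app U
        ((prodComparison (G ⋙ yon) X X).hom.app U g) =
      (prod.snd : (G ⋙ yon).obj X ⨯ (G ⋙ yon).obj X ⟶ _).hom.app U
        ((prodComparison (G ⋙ yon) X X).hom.app U g)) ↔
      secHom (B := G.obj (X ⨯ X)) g ≫ G.map prod.fst =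
        secHom (B := G.obj (X ⨯ X)) g ≫ G.map prod.snd := by
    constructor
    · intro h
      exact congrArg ULift.down (e1.symm.trans (h.trans e2))
    · intro h
      exact e1.trans (Eq.trans (ULift.ext _ _ h) e2.symm)
  refine Iff.trans ?_ h1.symm
  constructor
  · intro H
    refine hom_ext_tracks fun a y hy => ?_
    obtain ⟨z, hz, hy⟩ := (tracks_comp _ _ _ _).mp hy
    replace hy := (tracks_G_map _ _ _).mp hy
    refine (tracks_comp _ _ _ _).mpr ⟨z, hz, (tracks_G_map _ _ _).mpr ?_⟩
    exact X.vanishes_triangle (X.vanishes_symm ((he z).mp (H a z hz))) hy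
  · intro H a z hz
    refine (he z).mpr ?_
    have h2 : Tracks (secHom (B := G.obj (X ⨯ X)) g ≫ G.map prod.fst) a _ :=
      (tracks_comp _ _ _ _).mpr ⟨z, hz, tracks_G_map_self prod.fst z⟩
    have h3 : Tracks (secHom (B := G.obj (X ⨯ X)) g ≫ G.map prod.fst) a _ :=
      H ▸ (tracks_comp _ _ _ _).mpr ⟨z, hz, tracks_G_map_self prod.snd z⟩
    exact h2.unique h3

theorem isHyperdoctrineEmbedding_predSub :
    IsHyperdoctrineEmbedding CMT.{u} (subDoctrine CohSheaf.{u}) (G ⋙ yon) predSub where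
  preservesFiniteProducts := inferInstance
  prelatticeHom X := isPrelatticeHom_predSub X
  natural {X Y} f α := by
    have h : predSub X (CMT.map f α) =
        (Subobject.pullback ((G ⋙ yon).map f)).obj (predSub Y α) :=
      secs_injective ((secs_predSub_map f α).trans (secs_pullback _ _).symm)
    exact ⟨h.le, h.ge⟩
  map_exists π hπ α e he := (isExists_iff_secs _ _ _).mpr (secs_predSub_exists hπ α e he)
  map_forall π hπ α e he := (isForall_iff_secs _ _ _).mpr (secs_predSub_forall hπ α e he)
  map_eq X e e' he he' := by
    have h : predSub (X ⨯ X) e = (Subobject.pullback (prodComparison (G ⋙ yon) X X)).obj e' :=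
      secs_injective ((secs_predSub_eq e he e' ((isEq_iff_secs _).mp he')).trans
        (secs_pullback _ _).symm)
    exact ⟨h.le, h.ge⟩
  full := inferInstance
  faithful := inferInstance
  le_iff_le X α β := predSub_le_iff α β

/-- Sheaves on `PER(U)` are sheaves on a site that is small relative to `Type (u + 1)`: lifting the
hom-sets to `Type (u + 1)` suffices. -/
theorem isGrothendieckTopos_cohSheaf : IsGrothendieckTopos.{u + 1} CohSheaf.{u} :=
  ⟨ULiftHom.{u + 1} PERU.{u}, inferInstance,
    ULiftHom.equiv.inverse.inducedTopology coherentTop.{u},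
    ⟨ULiftHom.equiv.sheafCongr coherentTop.{u} _ (Type (u + 1))⟩⟩

end Embedding

end ContLogic

theorem mainTheorem2 :
    ∃ J : GrothendieckTopology PERU.{u},
      (∀ (A : PERU.{u}) (S : Sieve A), S ∈ J A ↔ IsCoherentCovering S) ∧
      IsGrothendieckTopos.{u + 1} (Sheaf J (Type (u + 1))) ∧
      CMT.{u}.IsUniversallyCoherent ∧
      (subDoctrine (Sheaf J (Type (u + 1)))).IsUniversallyCoherent ∧
      ∃ (_ : J.Subcanonical)
        (η : ∀ X : CMet.{u}, CMT.Pred X →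
          (subDoctrine (Sheaf J (Type (u + 1)))).Pred
            ((G ⋙ GrothendieckTopology.uliftYoneda.{u + 1} J).obj X)),
        (∀ (X : CMet.{u}) (φ : CMT.Pred X),
          ∃ _ : Mono ((GrothendieckTopology.uliftYoneda.{u + 1} J).map (predIncl X φ)),
            η X φ = Subobject.mk
              ((GrothendieckTopology.uliftYoneda.{u + 1} J).map (predIncl X φ))) ∧
        IsHyperdoctrineEmbedding CMT.{u} (subDoctrine (Sheaf J (Type (u + 1))))
          (G ⋙ GrothendieckTopology.uliftYoneda.{u + 1} J) η :=
  ⟨PERU.coherentTop, fun _ S => PERU.mem_coherentTop S, isGrothendieckTopos_cohSheaf,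
    CMT_isUniversallyCoherent, subDoctrine_sheaf_isUniversallyCoherent _,
    PERU.subcanonical_coherentTop, predSub,
    fun X φ => ⟨mono_yon_predIncl X φ, rfl⟩, isHyperdoctrineEmbedding_predSub⟩
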